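/- Let $\mathsf k$ be an infinite field, let $u>r\ge 2$ and $1\le k\le r-1$ be integers, and put $Q=(u,u-r)$, $n=2u-r$. **Burge code.** For a partition $P$ let $f_i$ ($i\ge 1$) be the number of parts of $P$ equal to $i$. Parse $f=(f_1,f_2,\dots)$ from right to left, pairing $(f_{j-1},f_j)$ whenever $f_j>0$ and $f_j$ has not already been paired with $f_{j+1}$; let $R(P)$ be the set of the indices $j$ so obtained. Let $\partial P$ be the partition obtained by replacing, for each $j\in R(P)$, one part $j$ by a part $j-1$ (dropping zero parts). The Burge code of $P$ is the word $w_1w_2\cdots w_m$, where $m=\min\{i\ge 1:\partial^{i-1}P \text{ is the empty partition}\}$ and $w_i=\beta$ if $1\in R(\partial^{i-1}P)$, $w_i=\alpha$ otherwise. **The locus.** Let $J_Q$ be the nilpotent upper triangular Jordan matrix with blocks of sizes $u$ and $u-r$, and let $\mathcal N_{J_Q}$ be the set of nilpotent $n\times n$ matrices over $\mathsf k$ that commute with $J_Q$. For $B\in\mathcal N_{J_Q}$, in the block form given by $J_Q$, let $(0,a_1,\dots,a_{u-1})$ be the first row of the upper left block, $(g_0,\dots,g_{u-r-1})$ that of the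 upper right block, $(0,\dots,0,h_0,\dots,h_{u-r-1})$ (with $r$ zeros) that of the lower left block and $(0,b_1,\dots,b_{u-r-1})$ that of the lower right block. For $1\le l\le u-r$ let $X^Q_{k,l}\subseteq\mathcal N_{J_Q}$ be defined by the equations $$a_1=\dots=a_{k-1}=0,\qquad b_1=\dots=b_{l-1}=0$$ if $k+l\le r$, and by $$a_1=\dots=a_{k-1}=0,\quad b_1=\dots=b_{r-k-1}=0,\quad \sum_{j=0}^{s}\bigl(a_{k+j}\,b_{r-k+s-j}-g_j\,h_{s-j}\bigr)=0\quad(0\le s\le k+l-r-1)$$ if $k+l\ge r+1$. **Proposition.** There is exactly one partition, denoted $P^Q_{k,u-r}$, whose Burge code is $\beta^{u-r}\alpha^{r-k}\beta^{k}\alpha$; it is a partition of $n$. A generic element $B$ of $X^Q_{k,u-r}$ has Jordan type $P^Q_{k,u-r}$: there is a Zariski open dense subset of $X^Q_{k,u-r}$ such that every matrix $B$ in it is conjugate to a Jordan matrix whose block sizes are the parts of $P^Q_{k,u-r}$. -/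

import Mathlib

/-! ### The Burge code of a partition

A partition is given by the multiset of its (positive) parts; its frequency sequence is
`i ↦ P.count i`. -/

/-- The two letters of a Burge code. -/
inductive BurgeLetter where
  | α : BurgeLetter
  | β : BurgeLetter

/-- Parse the frequency sequence of `P` from right to left, pairing `(f (j-1), f j)` whenever
`f j > 0`: the index `j` is the right end of a backward pair exactly when `f j > 0` and `j` has not
already been used as the left end of the pair `(f j, f (j+1))`. -/
def isBackwardPair (P : Multiset ℕ) (j : ℕ) : Bool :=
  if _h : j ∈ P then !isBackwardPair P (j + 1) else false
termination_by P.sup + 1 - j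
decreasing_by
  have : j ≤ P.sup := Multiset.le_sup _h
  omega

/-- The set `R(P)` of right ends of the backward pairs of the frequency sequence of `P`. -/
def burgeR (P : Multiset ℕ) : Finset ℕ :=
  P.toFinset.filter fun j => isBackwardPair P j = true

/-- The map `∂`: for each `j ∈ R(P)`, replace `(f (j-1), f j)` by `(f (j-1) + 1, f j - 1)`, that is,
replace one part `j` by a part `j - 1`; parts that become `0` are dropped. -/
def burgeD (P : Multiset ℕ) : Multiset ℕ :=
  ((P - (burgeR P).val) + (burgeR P).val.map fun j => j - 1).filter fun i => 0 < i

/-- The letter of `P`: `β` if `1 ∈ R(P)` and `α` otherwise. -/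
def burgeLetter (P : Multiset ℕ) : BurgeLetter :=
  if 1 ∈ burgeR P then BurgeLetter.β else BurgeLetter.α

/-- The Burge code of `P`: the word of the letters of `P, ∂P, ∂²P, …` up to and including the first
`∂ⁱP` that is the empty partition. -/
noncomputable def burgeCode (P : Multiset ℕ) : List BurgeLetter :=
  (List.range (sInf {i : ℕ | burgeD^[i] P = 0} + 1)).map fun i => burgeLetter (burgeD^[i] P)

/-- The word `α^(u-r-l) β^l α^(r-k) β^k α`, for `l ≤ u - r` and `k ≤ r`. -/
def tableWord (u r k l : ℕ) : List BurgeLetter :=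
  List.replicate (u - r - l) BurgeLetter.α ++ List.replicate l BurgeLetter.β ++
    List.replicate (r - k) BurgeLetter.α ++ List.replicate k BurgeLetter.β ++ [BurgeLetter.α]

/-! ### Jordan type -/

/-- The nilpotent upper triangular Jordan block of size `n`. -/
def jordanBlock (K : Type*) [Field K] (n : ℕ) : Matrix (Fin n) (Fin n) K :=
  Matrix.of fun i j => if (i : ℕ) + 1 = j then 1 else 0

/-- The block diagonal matrix whose blocks are the nilpotent Jordan blocks with sizes in `L`. -/
def jordanMatrix (K : Type*) [Field K] (L : List ℕ) :
    Matrix ((i : Fin L.length) × Fin (L.get i)) ((i : Fin L.length) × Fin (L.get i)) K :=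
  Matrix.blockDiagonal' fun i => jordanBlock K (L.get i)

/-- `B` is a (nilpotent) matrix of Jordan type `P`: it is conjugate to a Jordan matrix whose blocks
have the parts of `P` as their sizes (`e` only numbers the rows and columns). -/
def HasJordanType {K : Type*} [Field K] {ι : Type*} [Fintype ι] [DecidableEq ι] {n : ℕ}
    (B : Matrix ι ι K) (P : n.Partition) : Prop :=
  ∃ (L : List ℕ) (e : ((i : Fin L.length) × Fin (L.get i)) ≃ ι) (S : GL ι K),
    (L : Multiset ℕ) = P.parts ∧
      (S : Matrix ι ι K)⁻¹ * B * (S : Matrix ι ι K) = Matrix.reindex e e (jordanMatrix K L)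

/-! ### The nilpotent commutator of `J_Q`, `Q = (u, u - r)`, and the loci `X^Q_{k,l}` -/

/-- Square matrices of size `u + (u - r)`, with rows and columns in two blocks. -/
abbrev BlockMatrix (K : Type*) (u r : ℕ) : Type _ :=
  Matrix (Fin u ⊕ Fin (u - r)) (Fin u ⊕ Fin (u - r)) K

/-- The Jordan matrix `J_Q` of Jordan type `Q = (u, u - r)`. -/
def jordanQ (K : Type*) [Field K] (u r : ℕ) : BlockMatrix K u r :=
  Matrix.fromBlocks (jordanBlock K u) 0 0 (jordanBlock K (u - r))

/-- The set of nilpotent matrices commuting with `J_Q`. -/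
def nilpotentCommutator (K : Type*) [Field K] (u r : ℕ) : Set (BlockMatrix K u r) :=
  {B | IsNilpotent B ∧ B * jordanQ K u r = jordanQ K u r * B}

section Coordinates

variable {K : Type*} [Field K] {u r : ℕ}

/-- The coordinate `a_i` of `B`, `i < u`: the `i`-th entry of the first row of the upper left block
(rows and columns are numbered from `0`). The values outside the index ranges are never used. -/
def coordA (B : BlockMatrix K u r) (i : ℕ) : K :=
  if h : i < u then B (Sum.inl ⟨0, by omega⟩) (Sum.inl ⟨i, h⟩) else 0

/-- The coordinate `b_i` of `B`, `i < u - r`: first row of the lower right block. -/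
def coordB (B : BlockMatrix K u r) (i : ℕ) : K :=
  if h : i < u - r then B (Sum.inr ⟨0, by omega⟩) (Sum.inr ⟨i, h⟩) else 0

/-- The coordinate `g_i` of `B`, `i < u - r`: first row of the upper right block. -/
def coordG (B : BlockMatrix K u r) (i : ℕ) : K :=
  if h : i < u - r then B (Sum.inl ⟨0, by omega⟩) (Sum.inr ⟨i, h⟩) else 0

/-- The coordinate `h_i` of `B`, `i < u - r`: first row of the lower left block, whose first `r`
entries vanish when `B` commutes with `J_Q`. -/
def coordH (B : BlockMatrix K u r) (i : ℕ) : K :=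
  if h : i < u - r then B (Sum.inr ⟨0, by omega⟩) (Sum.inl ⟨r + i, by omega⟩) else 0

end Coordinates

/-- The variety `X^Q_{k,l}` in the nilpotent commutator of `J_Q`, `Q = (u, u - r)`,
for `1 ≤ k ≤ r - 1` and `1 ≤ l ≤ u - r`. -/
def locusX (K : Type*) [Field K] (u r k l : ℕ) : Set (BlockMatrix K u r) :=
  {B | B ∈ nilpotentCommutator K u r ∧
    (∀ i, 1 ≤ i → i ≤ k - 1 → coordA B i = 0) ∧
    (k + l ≤ r → ∀ i, 1 ≤ i → i ≤ l - 1 → coordB B i = 0) ∧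
    (r + 1 ≤ k + l →
      (∀ i, 1 ≤ i → i ≤ r - k - 1 → coordB B i = 0) ∧
      ∀ s, s ≤ k + l - r - 1 →
        ∑ j ∈ Finset.range (s + 1),
          (coordA B (k + j) * coordB B (r - k + (s - j)) - coordG B j * coordH B (s - j)) = 0)}

/-! ### Zariski topology and generic elements -/

/-- A set of matrices is Zariski closed if it is the common zero set of a set of polynomials in the
matrix entries. -/
def IsZariskiClosed {K : Type*} [Field K] {ι : Type*} (Z : Set (Matrix ι ι K)) : Prop :=
  ∃ E : Set (MvPolynomial (ι × ι) K),
    Z = {B | ∀ p ∈ E, MvPolynomial.eval (fun x : ι × ι => B x.1 x.2) p = 0}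

/-- A property holds for a generic element of `X` if it holds on a Zariski open dense subset of `X`:
there is a Zariski closed `Z` such that `X \ Z` is Zariski dense in `X` (every Zariski closed set
containing `X \ Z` contains `X`) and the property holds on `X \ Z`. -/
def HoldsGenerically {K : Type*} [Field K] {ι : Type*} (X : Set (Matrix ι ι K))
    (p : Matrix ι ι K → Prop) : Prop :=
  ∃ Z : Set (Matrix ι ι K), IsZariskiClosed Z ∧
    (∀ Y : Set (Matrix ι ι K), IsZariskiClosed Y → X \ Z ⊆ Y → X ⊆ Y) ∧
    ∀ B ∈ X \ Z, p B

/-! ### The Burge code -/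

/-! A matrix commuting with `J_Q` is a `K[X]`-endomorphism of `K[X]/(X^u) ⊕ K[X]/(X^(u-r))`, acting
on row vectors, so it is a 2×2 matrix of truncated power series. On the locus its entries are `X^k
a`, `g`, `X^r h`, `X^(r-k) b`, and the remaining equations say that `ab - gh` vanishes modulo a
power of `X` (`mem_locusX_iff`).

If `a` is a unit, then `h = ca` and `b ≡ gc`, so the matrix factors through `N = K[X]/(X^(u-k))` as
a surjection followed by an injection. The composite in the opposite order is multiplication on `N`
by `X^k a + X^(r-k) c g`, generically `X^m` times a unit with `m = min k (r-k)`. Its Jordan type is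
the most even partition of `u-k` into `m` parts (`span_truncVec_chain`). Reversing the factorization
lengthens each block by one and adds blocks of size one (`exists_jordan_basis`).

The Burge code of the resulting partition is computed one letter at a time (`burgeCode_table`). It
determines the partition because a partition can be rebuilt from `∂P` and its first letter
(`burge_injective`).

Genericity means that one polynomial does not vanish. Density is shown without irreducibility:
parabolas inside the locus successively deform every point into generic ones
(`locusMatrix_mem_of_generic_subset`). -/

theorem mem_burgeR {P : Multiset ℕ} {j : ℕ} : j ∈ burgeR P ↔ j ∈ P ∧ j + 1 ∉ burgeR P := by
  have key : ∀ j, j ∈ burgeR P ↔ isBackwardPair P j = true := by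
    intro j
    simp only [burgeR, Finset.mem_filter, Multiset.mem_toFinset, and_iff_right_iff_imp]
    intro h
    by_contra hj
    rw [isBackwardPair] at h
    simp [hj] at h
  rw [key, key, isBackwardPair]
  by_cases h : j ∈ P <;> simp [h]

theorem burgeR_le (P : Multiset ℕ) : (burgeR P).val ≤ P :=
  (Finset.val_le_iff.2 (Finset.filter_subset _ _)).trans (Multiset.dedup_le P)

/-- Above the largest part both sets are empty, and the recursion then decides membership downwards.
Hence `R(P)` can be identified by guessing it and checking the recursion. -/
theorem eq_burgeR {P : Multiset ℕ} {R : Finset ℕ} (h : ∀ j, j ∈ R ↔ j ∈ P ∧ j + 1 ∉ R) :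
    burgeR P = R := by
  have key : ∀ n j, P.sup < j + n → (j ∈ burgeR P ↔ j ∈ R) := by
    intro n
    induction n with
    | zero =>
      intro j hj
      have : j ∉ P := fun hP => absurd (Multiset.le_sup hP) (by omega)
      rw [mem_burgeR, h]
      simp [this]
    | succ n ih =>
      intro j hj
      rw [mem_burgeR, h, ih (j + 1) (by omega)]
  ext j
  exact key (P.sup + 1) j (by omega)

theorem count_burgeD (P : Multiset ℕ) {i : ℕ} (hi : 0 < i) :
    (burgeD P).count i + (if i ∈ burgeR P then 1 else 0) =
      P.count i + (if i + 1 ∈ burgeR P then 1 else 0) := by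
  have h1 : ∀ R : Finset ℕ, (R.val.map fun j => j - 1).count i = if i + 1 ∈ R then 1 else 0 := by
    intro R
    rw [Multiset.count_map]
    have : R.val.filter (fun a => i = a - 1) = (R.filter (fun a => a = i + 1)).val := by
      rw [Finset.filter_val]
      exact Multiset.filter_congr fun a _ => by omega
    rw [this, Finset.filter_eq', Finset.card_val]
    split_ifs <;> simp
  have h2 : (burgeR P).val.count i = if i ∈ burgeR P then 1 else 0 := by
    split_ifs with h
    · exact Multiset.count_eq_one_of_mem (burgeR P).nodup h
    · exact Multiset.count_eq_zero_of_notMem h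
  have h3 := Multiset.count_le_of_le i (burgeR_le P)
  rw [burgeD, Multiset.count_filter_of_pos hi, Multiset.count_add, Multiset.count_sub, h1, ← h2]
  omega

theorem pos_of_mem_burgeD {P : Multiset ℕ} {i : ℕ} (hi : i ∈ burgeD P) : 0 < i :=
  (Multiset.mem_filter.1 hi).2

theorem ext_count_pos {P P' : Multiset ℕ} (hP : ∀ i ∈ P, 0 < i) (hP' : ∀ i ∈ P', 0 < i)
    (h : ∀ i, 0 < i → P.count i = P'.count i) : P = P' := by
  ext i
  rcases Nat.eq_zero_or_pos i with rfl | hi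
  · rw [Multiset.count_eq_zero_of_notMem fun h => (hP 0 h).false,
      Multiset.count_eq_zero_of_notMem fun h => (hP' 0 h).false]
  · exact h i hi

theorem burgeD_eq {P G : Multiset ℕ} (R : Finset ℕ) (hR : ∀ j, j ∈ R ↔ j ∈ P ∧ j + 1 ∉ R)
    (hG : ∀ i ∈ G, 0 < i) (h : ∀ i, 0 < i → G.count i + (if i ∈ R then 1 else 0) =
      P.count i + (if i + 1 ∈ R then 1 else 0)) : burgeD P = G := by
  refine ext_count_pos (fun i => pos_of_mem_burgeD) hG fun i hi => ?_
  have := count_burgeD P hi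
  rw [eq_burgeR hR] at this
  have := h i hi
  omega

/-- This reads `R(P)` from left to right out of `∂P`, opposite to the direction of its definition.
If `i ∈ R(P)` then `i + 1 ∉ R(P)`. If `i ∉ R(P)`, a part `i` of `∂P` either came down from `i + 1`
or was already in `P`; in the latter case only `i + 1 ∈ R(P)` can have prevented `i ∈ R(P)`. -/
theorem succ_mem_burgeR {P : Multiset ℕ} {i : ℕ} (hi : 0 < i) :
    i + 1 ∈ burgeR P ↔ i ∉ burgeR P ∧ i ∈ burgeD P := by
  have h := count_burgeD P hi
  have h1 := @mem_burgeR P i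
  rw [← Multiset.count_pos] at h1 ⊢
  split_ifs at h <;> grind

/-- The letter settles whether `1 ∈ R(P)`, `succ_mem_burgeR` propagates this to all of `R(P)`, and
`count_burgeD` then recovers the multiplicities. -/
theorem burge_injective {P P' : Multiset ℕ} (hP : ∀ i ∈ P, 0 < i) (hP' : ∀ i ∈ P', 0 < i)
    (hD : burgeD P = burgeD P') (hl : burgeLetter P = burgeLetter P') : P = P' := by
  have h1 : 1 ∈ burgeR P ↔ 1 ∈ burgeR P' := by
    unfold burgeLetter at hl
    split_ifs at hl <;> simp_all
  have hR : ∀ i, 0 < i → (i ∈ burgeR P ↔ i ∈ burgeR P') := by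
    intro i hi
    induction i, hi using Nat.le_induction with
    | base => exact h1
    | succ i hi ih => rw [succ_mem_burgeR hi, succ_mem_burgeR hi, ih, hD]
  refine ext_count_pos hP hP' fun i hi => ?_
  have h2 := count_burgeD P hi
  have h3 := count_burgeD P' hi
  rw [hD] at h2
  simp only [hR i hi, hR (i + 1) (by omega)] at h2
  omega

theorem sum_burgeD (P : Multiset ℕ) (hP : ∀ i ∈ P, 0 < i) :
    (burgeD P).sum + (burgeR P).card = P.sum := by
  have h0 : ∀ s : Multiset ℕ, (s.filter fun i => 0 < i).sum = s.sum := by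
    intro s
    induction s using Multiset.induction_on with
    | empty => simp
    | cons a s ih =>
      rcases Nat.eq_zero_or_pos a with rfl | ha
      · simp [ih]
      · simp [ha, ih]
  have h1 : ∀ s : Multiset ℕ, (∀ i ∈ s, 0 < i) → (s.map fun j => j - 1).sum + s.card = s.sum := by
    intro s
    induction s using Multiset.induction_on with
    | empty => simp
    | cons a s ih =>
      intro h
      have := ih fun i hi => h i (Multiset.mem_cons_of_mem hi)
      have := h a (Multiset.mem_cons_self a s)
      simp only [Multiset.map_cons, Multiset.sum_cons, Multiset.card_cons]
      omega
  have h2 := h1 (burgeR P).val fun i hi => hP i (Multiset.mem_of_le (burgeR_le P) hi)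
  have h3 := congrArg Multiset.sum (tsub_add_cancel_of_le (burgeR_le P))
  rw [Multiset.sum_add] at h3
  rw [Finset.card_val] at h2
  rw [burgeD, h0, Multiset.sum_add]
  omega

theorem burgeR_nonempty {P : Multiset ℕ} (hP : P ≠ 0) : (burgeR P).Nonempty := by
  by_contra h
  rw [Finset.not_nonempty_iff_eq_empty] at h
  obtain ⟨a, ha⟩ := Multiset.exists_mem_of_ne_zero hP
  have := @mem_burgeR P a
  simp [h, ha] at this

theorem exists_iterate_burgeD (P : Multiset ℕ) (hP : ∀ i ∈ P, 0 < i) :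
    ∃ i, burgeD^[i] P = 0 := by
  induction hn : P.sum using Nat.strong_induction_on generalizing P with
  | _ n ih =>
    by_cases h0 : P = 0
    · exact ⟨0, h0⟩
    · have h1 := sum_burgeD P hP
      have h2 := (burgeR_nonempty h0).card_pos
      obtain ⟨i, hi⟩ := ih _ (by omega) (burgeD P) (fun _ => pos_of_mem_burgeD) rfl
      exact ⟨i + 1, hi⟩

theorem burgeCode_zero : burgeCode 0 = [BurgeLetter.α] := by
  have h : sInf {i : ℕ | burgeD^[i] 0 = 0} = 0 := Nat.sInf_eq_zero.2 (Or.inl rfl)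
  have h1 : burgeR 0 = ∅ := by simp [burgeR]
  simp [burgeCode, h, burgeLetter, h1]

theorem burgeCode_of_ne_zero {P : Multiset ℕ} (hP : ∀ i ∈ P, 0 < i) (h0 : P ≠ 0) :
    burgeCode P = burgeLetter P :: burgeCode (burgeD P) := by
  have h : sInf {i : ℕ | burgeD^[i] P = 0} = sInf {i : ℕ | burgeD^[i] (burgeD P) = 0} + 1 := by
    have hne : 0 < sInf {i : ℕ | burgeD^[i] P = 0} := by
      refine Nat.pos_of_ne_zero fun h => ?_
      -- An infimum of `0` could also come from the empty set; termination of the iteration excludes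
      -- this.
      rcases Nat.sInf_eq_zero.1 h with h | h
      · exact h0 h
      · obtain ⟨i, hi⟩ := exists_iterate_burgeD P hP
        exact Set.eq_empty_iff_forall_notMem.1 h i hi
    exact (Nat.sInf_add hne).symm
  rw [burgeCode, h, List.range_succ_eq_map, List.map_cons, List.map_map]
  rfl

theorem burgeCode_injective {P P' : Multiset ℕ} (hP : ∀ i ∈ P, 0 < i) (hP' : ∀ i ∈ P', 0 < i)
    (h : burgeCode P = burgeCode P') : P = P' := by
  have hne : ∀ P, burgeCode P ≠ [] := by simp [burgeCode]
  induction hn : P.sum using Nat.strong_induction_on generalizing P P' with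
  | _ n ih =>
    by_cases h0 : P = 0 <;> by_cases h0' : P' = 0
    · rw [h0, h0']
    · rw [h0, burgeCode_zero, burgeCode_of_ne_zero hP' h0'] at h
      exact absurd (List.cons_eq_cons.1 h).2.symm (hne _)
    · rw [h0', burgeCode_zero, burgeCode_of_ne_zero hP h0] at h
      exact absurd (List.cons_eq_cons.1 h).2 (hne _)
    · rw [burgeCode_of_ne_zero hP h0, burgeCode_of_ne_zero hP' h0'] at h
      obtain ⟨hl, h⟩ := List.cons_eq_cons.1 h
      have h1 := sum_burgeD P hP
      have h2 := (burgeR_nonempty h0).card_pos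
      exact burge_injective hP hP'
        (ih _ (by omega) (fun _ => pos_of_mem_burgeD) (fun _ => pos_of_mem_burgeD) h rfl) hl

/-! ### The partitions occurring in the table -/

/-- The partition of `d` into `c` parts which are as equal as possible. -/
def balanced (c d : ℕ) : Multiset ℕ := (Multiset.range c).map fun i => (d + i) / c

/-- Passing from `d` to `d + 1` shifts the index `i` by one: the quotients `(d + i) / c` for `0 < i
< c` are common, while `d / c` is exchanged for `(d + c) / c = d / c + 1`. Read backwards, this is
one Burge step on a largest part. -/
theorem balanced_step {c : ℕ} (hc : 0 < c) (d : ℕ) :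
    ∃ X : Multiset ℕ, balanced c d = d / c ::ₘ X ∧ balanced c (d + 1) = (d / c + 1) ::ₘ X ∧
      ∀ x ∈ X, x = d / c ∨ x = d / c + 1 := by
  obtain ⟨c, rfl⟩ : ∃ n, c = n + 1 := ⟨c - 1, by omega⟩
  refine ⟨(Multiset.range c).map fun i => (d + 1 + i) / (c + 1), ?_, ?_, ?_⟩
  · have : Multiset.range (c + 1) = 0 ::ₘ (Multiset.range c).map Nat.succ := by
      simp [Multiset.range, List.range_succ_eq_map]
    rw [balanced, this, Multiset.map_cons, Multiset.map_map]
    simp [Nat.add_assoc, Nat.add_comm 1]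
  · rw [balanced, Multiset.range_succ, Multiset.map_cons,
      show d + 1 + c = d + (c + 1) by omega, Nat.add_div_right _ hc]
  · intro x hx
    obtain ⟨i, hi, rfl⟩ := Multiset.mem_map.1 hx
    rw [Multiset.mem_range] at hi
    have h1 : d / (c + 1) ≤ (d + 1 + i) / (c + 1) := Nat.div_le_div_right (by omega)
    have h2 : (d + 1 + i) / (c + 1) ≤ (d + (c + 1)) / (c + 1) := Nat.div_le_div_right (by omega)
    rw [Nat.add_div_right _ hc] at h2
    omega

theorem sum_balanced {c : ℕ} (hc : 0 < c) (d : ℕ) : (balanced c d).sum = d := by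
  induction d with
  | zero =>
    refine Multiset.sum_eq_zero fun x hx => ?_
    obtain ⟨i, hi, rfl⟩ := Multiset.mem_map.1 hx
    rw [Multiset.mem_range] at hi
    simpa using Nat.div_eq_of_lt hi
  | succ d ih =>
    obtain ⟨X, h1, h2, -⟩ := balanced_step hc d
    rw [h1, Multiset.sum_cons] at ih
    rw [h2, Multiset.sum_cons]
    omega

theorem balanced_add_self {c : ℕ} (hc : 0 < c) (d : ℕ) :
    balanced c (d + c) = (balanced c d).map (· + 1) := by
  rw [balanced, balanced, Multiset.map_map]
  refine Multiset.map_congr rfl fun i _ => ?_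
  rw [Function.comp_apply, show d + c + i = d + i + c by omega, Nat.add_div_right _ hc]

theorem balanced_eq_replicate {k c : ℕ} (hc : c ≤ k) :
    balanced k (k + c) = Multiset.replicate c 2 + Multiset.replicate (k - c) 1 := by
  rcases Nat.eq_zero_or_pos k with rfl | hk
  · simp [balanced, Nat.le_zero.1 hc]
  induction c with
  | zero =>
    rw [Multiset.replicate_zero, zero_add, Multiset.eq_replicate]
    refine ⟨by simp [balanced], fun x hx => ?_⟩
    obtain ⟨i, hi, rfl⟩ := Multiset.mem_map.1 hx
    rw [Multiset.mem_range] at hi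
    rw [Nat.div_eq_of_lt_le] <;> omega
  | succ c ih =>
    obtain ⟨X, h1, h2, -⟩ := balanced_step hk (k + c)
    have hq : (k + c) / k = 1 := by rw [Nat.div_eq_of_lt_le] <;> omega
    rw [hq] at h1 h2
    rw [ih (by omega), show k - c = k - (c + 1) + 1 by omega, Multiset.replicate_succ,
      Multiset.add_cons, Multiset.cons_inj_right] at h1
    rw [← add_assoc, h2, ← h1, Multiset.replicate_succ, Multiset.cons_add]

theorem pos_of_mem_balanced {c d : ℕ} (hcd : c ≤ d) {x : ℕ} (hx : x ∈ balanced c d) : 0 < x := by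
  obtain ⟨i, hi, rfl⟩ := Multiset.mem_map.1 hx
  rw [Multiset.mem_range] at hi
  exact Nat.div_pos (by omega) (by omega)

/-- Lowering one of the largest parts when there are two adjacent part sizes. -/
theorem burgeCode_cons_alpha {q : ℕ} (hq : 1 ≤ q) {X : Multiset ℕ}
    (hX : ∀ x ∈ X, x = q ∨ x = q + 1) :
    burgeCode ((q + 1) ::ₘ X) = BurgeLetter.α :: burgeCode (q ::ₘ X) := by
  have hR : ∀ j, j ∈ ({q + 1} : Finset ℕ) ↔
      j ∈ (q + 1) ::ₘ X ∧ j + 1 ∉ ({q + 1} : Finset ℕ) := by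
    intro j
    have := hX j
    simp only [Finset.mem_singleton, Multiset.mem_cons]
    grind
  have hD : burgeD ((q + 1) ::ₘ X) = q ::ₘ X := by
    refine burgeD_eq _ hR ?_ ?_
    · intro i hi
      have := hX i
      grind
    · intro i hi
      simp only [Multiset.count_cons, Finset.mem_singleton]
      grind
  rw [burgeCode_of_ne_zero _ (Multiset.cons_ne_zero), hD, burgeLetter, eq_burgeR hR, if_neg]
  · simp; omega
  · intro i hi
    have := hX i
    grind

/-- Lowering one of the largest parts together with a part `1`. -/
theorem burgeCode_cons_beta {q : ℕ} (hq : 2 ≤ q) {X : Multiset ℕ}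
    (hX : ∀ x ∈ X, x = q ∨ x = q + 1) (e : ℕ) :
    burgeCode ((q + 1) ::ₘ X + Multiset.replicate (e + 1) 1) =
      BurgeLetter.β :: burgeCode (q ::ₘ X + Multiset.replicate e 1) := by
  have hR : ∀ j, j ∈ ({q + 1, 1} : Finset ℕ) ↔
      j ∈ (q + 1) ::ₘ X + Multiset.replicate (e + 1) 1 ∧ j + 1 ∉ ({q + 1, 1} : Finset ℕ) := by
    intro j
    have := hX j
    simp only [Finset.mem_singleton, Finset.mem_insert, Multiset.mem_cons, Multiset.mem_add,
      Multiset.mem_replicate]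
    grind
  have hD : burgeD ((q + 1) ::ₘ X + Multiset.replicate (e + 1) 1) =
      q ::ₘ X + Multiset.replicate e 1 := by
    refine burgeD_eq _ hR ?_ ?_
    · intro i hi
      have := hX i
      grind [Multiset.mem_replicate]
    · intro i hi
      simp only [Multiset.count_cons, Multiset.count_add, Multiset.count_replicate,
        Finset.mem_singleton, Finset.mem_insert]
      grind
  rw [burgeCode_of_ne_zero _ (by simp), hD, burgeLetter, eq_burgeR hR, if_pos]
  · simp
  · intro i hi
    have := hX i
    grind [Multiset.mem_replicate]

theorem burgeCode_replicate_one (k : ℕ) :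
    burgeCode (Multiset.replicate k 1) = List.replicate k BurgeLetter.β ++ [BurgeLetter.α] := by
  induction k with
  | zero => simpa using burgeCode_zero
  | succ k ih =>
    have hR : ∀ j, j ∈ ({1} : Finset ℕ) ↔
        j ∈ Multiset.replicate (k + 1) 1 ∧ j + 1 ∉ ({1} : Finset ℕ) := by
      intro j
      simp only [Finset.mem_singleton, Multiset.mem_replicate]
      grind
    have hD : burgeD (Multiset.replicate (k + 1) 1) = Multiset.replicate k 1 := by
      refine burgeD_eq _ hR ?_ ?_
      · intro i hi
        simp [Multiset.eq_of_mem_replicate hi]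
      · intro i hi
        simp only [Multiset.count_replicate, Finset.mem_singleton]
        grind
    rw [burgeCode_of_ne_zero _ (by simp), hD, burgeLetter, eq_burgeR hR, ih,
      List.replicate_succ]
    · simp
    · intro i hi
      simp [Multiset.eq_of_mem_replicate hi]

theorem burgeCode_balanced {k : ℕ} (hk : 0 < k) (m : ℕ) :
    burgeCode (balanced k (k + m)) = List.replicate m BurgeLetter.α ++
      List.replicate k BurgeLetter.β ++ [BurgeLetter.α] := by
  induction m with
  | zero =>
    have := balanced_eq_replicate (Nat.zero_le k)
    simp only [Multiset.replicate_zero, zero_add, Nat.sub_zero] at this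
    rw [this, burgeCode_replicate_one]
    rfl
  | succ m ih =>
    obtain ⟨X, h1, h2, h3⟩ := balanced_step hk (k + m)
    rw [← add_assoc, h2, burgeCode_cons_alpha (Nat.div_pos (by omega) hk) h3, ← h1, ih]
    rfl

/-- The bound `2 * c ≤ d` keeps the balanced parts at least `2` throughout, so in each step the part
`1` and the largest part are lowered independently. -/
theorem burgeCode_balanced_add {c d : ℕ} (hc : 0 < c) (hd : 2 * c ≤ d) (e t : ℕ) :
    burgeCode (balanced c (d + t) + Multiset.replicate (e + t) 1) =
      List.replicate t BurgeLetter.β ++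
        burgeCode (balanced c d + Multiset.replicate e 1) := by
  induction t with
  | zero => rfl
  | succ t ih =>
    obtain ⟨X, h1, h2, h3⟩ := balanced_step hc (d + t)
    rw [← add_assoc, h2, ← add_assoc, burgeCode_cons_beta ?_ h3, ← h1, ih]
    · rfl
    · rw [Nat.le_div_iff_mul_le hc]
      omega

/-- After `u - r` letters `β`, what remains is the most even partition of `r` into `k` parts. If `k
≤ r - k` the ones are used up; otherwise the balanced parts have all become `2`, and the ones left
complete the `k` parts. -/
theorem burgeCode_table {u r k : ℕ} (hru : r < u) (hk : 1 ≤ k) (hkr : k ≤ r - 1) :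
    burgeCode (balanced (min k (r - k)) (u - k + min k (r - k)) +
      Multiset.replicate (u - r + k - min k (r - k)) 1) = tableWord u r k (u - r) := by
  have h := burgeCode_balanced_add (c := min k (r - k)) (d := r - k + min k (r - k)) (by omega)
    (by omega) (k - min k (r - k)) (u - r)
  rw [show u - k + min k (r - k) = r - k + min k (r - k) + (u - r) by omega,
    show u - r + k - min k (r - k) = k - min k (r - k) + (u - r) by omega, h]
  have h2 : balanced (min k (r - k)) (r - k + min k (r - k)) +
      Multiset.replicate (k - min k (r - k)) 1 = balanced k (k + (r - k)) := by
    rcases le_total k (r - k) with h | h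
    · rw [min_eq_left h]
      simp [add_comm]
    · rw [min_eq_right h, balanced_eq_replicate h, balanced_eq_replicate le_rfl]
      simp
  rw [h2, burgeCode_balanced hk, tableWord]
  simp

/-! ### Jordan bases -/

theorem finrank_ker_add_of_surjective {K V N : Type*} [Field K] [AddCommGroup V] [Module K V]
    [AddCommGroup N] [Module K N] [FiniteDimensional K V] (φ : V →ₗ[K] N)
    (hφ : Function.Surjective φ) :
    Module.finrank K (LinearMap.ker φ) + Module.finrank K N = Module.finrank K V := by
  rw [← LinearMap.finrank_range_add_finrank_ker φ, LinearMap.range_eq_top.2 hφ, finrank_top,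
    add_comm]

/-- If an endomorphism factors as `ψ ∘ φ` with `φ` onto and `ψ` injective, then a Jordan basis
of `φ ∘ ψ` gives a Jordan basis of `ψ ∘ φ`: every chain becomes longer by one, and chains of
length one are added. -/
theorem exists_jordan_basis {K V N I : Type*} [Field K] [AddCommGroup V] [Module K V]
    [AddCommGroup N] [Module K N] [FiniteDimensional K V] [Fintype I]
    (φ : V →ₗ[K] N) (ψ : N →ₗ[K] V) (hφ : Function.Surjective φ) (hψ : Function.Injective ψ)
    (l : I → ℕ) (hl : ∀ i, 0 < l i) (b : Module.Basis ((i : I) × Fin (l i)) K N)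
    (e : I → ℕ → N) (hb : ∀ i j, b ⟨i, j⟩ = e i j) (he0 : ∀ i j, l i ≤ j → e i j = 0)
    (he : ∀ i j, φ (ψ (e i j)) = e i (j + 1)) (m : ℕ)
    (hm : Fintype.card I + Module.finrank K N + m = Module.finrank K V) :
    ∃ (b' : Module.Basis ((i : I ⊕ Fin m) × Fin (Sum.elim (fun i => l i + 1) (fun _ => 1) i)) K V)
      (e' : I ⊕ Fin m → ℕ → V), (∀ i j, b' ⟨i, j⟩ = e' i j) ∧
      (∀ i j, Sum.elim (fun i => l i + 1) (fun _ => 1) i ≤ j → e' i j = 0) ∧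
      ∀ i j, ψ (φ (e' i j)) = e' i (j + 1) := by
  -- The ends of the lengthened chains are independent vectors of `ker φ`. A complement of their
  -- span in `ker φ` supplies the chains of length one.
  have hlast : LinearIndependent K fun i => ψ (e i (l i - 1)) := by
    have h := (b.linearIndependent.comp (fun i => (⟨i, ⟨l i - 1, by have := hl i; omega⟩⟩ :
      (i : I) × Fin (l i))) fun i j h => congrArg Sigma.fst h).map' ψ (LinearMap.ker_eq_bot.2 hψ)
    simpa only [Function.comp_def, hb] using h
  have hlast0 : ∀ i, φ (ψ (e i (l i - 1))) = 0 := fun i => by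
    rw [he]
    exact he0 _ _ (by have := hl i; omega)
  set w : I → LinearMap.ker φ := fun i => ⟨ψ (e i (l i - 1)), hlast0 i⟩ with hw
  have hwi : LinearIndependent K w :=
    LinearIndependent.of_comp (LinearMap.ker φ).subtype (by simpa [Function.comp_def, hw] using hlast)
  obtain ⟨F, hF⟩ := Submodule.exists_isCompl (Submodule.span K (Set.range w))
  have hFm : Module.finrank K F = m := by
    have h1 := Submodule.finrank_add_eq_of_isCompl hF
    have h2 := finrank_span_eq_card hwi
    have h3 := finrank_ker_add_of_surjective φ hφ
    omega
  let f : Module.Basis (Fin m) K F := Module.finBasisOfFinrankEq K F hFm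
  choose z hz using fun i => hφ (e i 0)
  let e' : I ⊕ Fin m → ℕ → V := Sum.elim
    (fun i j => match j with | 0 => z i | j + 1 => ψ (e i j))
    (fun i j => match j with | 0 => ((f i : LinearMap.ker φ) : V) | _ + 1 => 0)
  have he'1 : ∀ i j, Sum.elim (fun i => l i + 1) (fun _ => 1) i ≤ j → e' i j = 0 := by
    rintro (i | i) (_ | j) hj
    · simp at hj
    · simp only [Sum.elim_inl] at hj
      simp [e', he0 i j (by omega)]
    · simp at hj
    · rfl
  have he'2 : ∀ i j, ψ (φ (e' i j)) = e' i (j + 1) := by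
    rintro (i | i) (_ | j)
    · simp [e', hz]
    · simp [e', he]
    · simp [e']
    · simp [e']
  let v : ((i : I ⊕ Fin m) × Fin (Sum.elim (fun i => l i + 1) (fun _ => 1) i)) → V :=
    fun x => e' x.1 x.2
  have hmem : ∀ i j, e' i j ∈ Submodule.span K (Set.range v) := by
    intro i j
    by_cases hj : j < Sum.elim (fun i => l i + 1) (fun _ => 1) i
    · exact Submodule.subset_span ⟨⟨i, ⟨j, hj⟩⟩, rfl⟩
    · rw [he'1 i j (not_lt.1 hj)]
      exact Submodule.zero_mem _
  have hker : LinearMap.ker φ ≤ Submodule.span K (Set.range v) := by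
    have h1 : Submodule.map (LinearMap.ker φ).subtype (Submodule.span K (Set.range w)) ≤
        Submodule.span K (Set.range v) := by
      rw [Submodule.map_span_le]
      rintro _ ⟨i, rfl⟩
      have := hmem (Sum.inl i) (l i - 1 + 1)
      simpa [e'] using this
    have h2 : Submodule.map (LinearMap.ker φ).subtype F ≤ Submodule.span K (Set.range v) := by
      have h3 : F = Submodule.span K (Set.range fun i => (f i : LinearMap.ker φ)) := by
        have := congrArg (Submodule.map F.subtype) f.span_eq
        rw [Submodule.map_span, ← Set.range_comp, Submodule.map_top, Submodule.range_subtype]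
          at this
        exact this.symm
      rw [h3, Submodule.map_span_le]
      rintro _ ⟨i, rfl⟩
      exact hmem (Sum.inr i) 0
    have h3 := congrArg (Submodule.map (LinearMap.ker φ).subtype) hF.sup_eq_top
    rw [Submodule.map_sup, Submodule.map_top, Submodule.range_subtype] at h3
    rw [← h3]
    exact sup_le h1 h2
  have hmap : Submodule.map φ (Submodule.span K (Set.range v)) = ⊤ := by
    rw [eq_top_iff, ← b.span_eq, Submodule.span_le]
    rintro _ ⟨⟨i, j, hj⟩, rfl⟩
    rw [hb]
    rcases j with _ | j
    · exact ⟨z i, hmem (Sum.inl i) 0, hz i⟩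
    · exact ⟨ψ (e i j), hmem (Sum.inl i) (j + 1), he i j⟩
  -- A subspace containing `ker φ` and mapping onto `N` is everything.
  have htop : ⊤ ≤ Submodule.span K (Set.range v) := by
    intro x _
    obtain ⟨y, hy, hxy⟩ : φ x ∈ Submodule.map φ (Submodule.span K (Set.range v)) := by
      rw [hmap]; trivial
    have : x - y ∈ LinearMap.ker φ := by simp [hxy]
    simpa using Submodule.add_mem _ (hker this) hy
  have hcard : Fintype.card ((i : I ⊕ Fin m) × Fin (Sum.elim (fun i => l i + 1) (fun _ => 1) i)) =
      Module.finrank K V := by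
    have h := Module.finrank_eq_card_basis b
    rw [Fintype.card_sigma] at h ⊢
    simp only [Fintype.card_fin] at h ⊢
    rw [Fintype.sum_sum_type]
    simp only [Sum.elim_inl, Sum.elim_inr, Finset.sum_add_distrib, Finset.sum_const,
      Finset.card_univ, smul_eq_mul, mul_one, Fintype.card_fin]
    omega
  refine ⟨basisOfTopLeSpanOfCardEqFinrank v htop hcard, e', fun i j => ?_, he'1, he'2⟩
  rw [coe_basisOfTopLeSpanOfCardEqFinrank]

/-- A Jordan basis (for the action on row vectors) determines the Jordan type. -/
theorem hasJordanType_of_basis {K ι I : Type*} [Field K] [Fintype ι] [DecidableEq ι] [Fintype I]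
    {n : ℕ} {B : Matrix ι ι K} {P : n.Partition} (l : I → ℕ)
    (b : Module.Basis ((i : I) × Fin (l i)) K (ι → K)) (e : I → ℕ → ι → K)
    (hb : ∀ i j, b ⟨i, j⟩ = e i j) (he0 : ∀ i j, l i ≤ j → e i j = 0)
    (he : ∀ i j, Matrix.vecMul (e i j) B = e i (j + 1))
    (hP : P.parts = (Finset.univ : Finset I).val.map l) : HasJordanType B P := by
  classical
  let E : Fin (Fintype.card I) ≃ I := (Fintype.equivFin I).symm
  let L : List ℕ := List.ofFn fun i => l (E i)
  have hL : L.length = Fintype.card I := List.length_ofFn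
  let E' : Fin L.length ≃ I := (finCongr hL).trans E
  have hE' : ∀ i, L.get i = l (E' i) := by
    intro i
    simp [L, E', List.get_eq_getElem]
    rfl
  let s : ((i : Fin L.length) × Fin (L.get i)) ≃ ((i : I) × Fin (l i)) :=
    Equiv.sigmaCongr E' fun i => finCongr (hE' i)
  have hcard : Fintype.card ((i : I) × Fin (l i)) = Fintype.card ι := by
    rw [← Module.finrank_eq_card_basis b, Module.finrank_fintype_fun_eq_card]
  let t : ((i : I) × Fin (l i)) ≃ ι := Fintype.equivOfCardEq hcard
  let eq := s.trans t
  let b' : Module.Basis ι K (ι → K) := b.reindex t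
  let T : Matrix ι ι K := Matrix.of fun i => b' i
  have hT : IsUnit T := by
    rw [← Matrix.linearIndependent_rows_iff_isUnit]
    exact b'.linearIndependent
  -- The basis vectors are the rows of `T`, so the chain relations read `T B = J T`; the conjugating
  -- matrix is therefore `T⁻¹`.
  have hTB : T * B = Matrix.reindex eq eq (jordanMatrix K L) * T := by
    have key : ∀ x : (i : Fin L.length) × Fin (L.get i),
        (T * B).row (eq x) = (Matrix.reindex eq eq (jordanMatrix K L) * T).row (eq x) := by
      intro x
      have hTx : ∀ x, T (eq x) = e (E' x.1) x.2 := by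
        intro x
        change b' (eq x) = _
        simp [b', eq, s, Equiv.sigmaCongr, hb]
      have h1 : (T * B).row (eq x) = Matrix.vecMul (T (eq x)) B := by
        ext j; rfl
      have h2 : (Matrix.reindex eq eq (jordanMatrix K L) * T).row (eq x) =
          ∑ y, jordanMatrix K L x y • T (eq y) := by
        ext j
        simp only [Matrix.row, Matrix.mul_apply, Finset.sum_apply, Pi.smul_apply, smul_eq_mul]
        rw [← eq.sum_comp]
        simp
      rw [h1, h2, hTx, he, Fintype.sum_sigma]
      obtain ⟨i, j⟩ := x
      rw [Finset.sum_eq_single i]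
      · by_cases hj : (j : ℕ) + 1 < L.get i
        · rw [Finset.sum_eq_single (⟨j + 1, hj⟩ : Fin (L.get i))]
          · simp [jordanMatrix, jordanBlock, Matrix.blockDiagonal'_apply_eq, hTx]
          · intro y _ hy
            have : ¬ ((j : ℕ) + 1 = y) := fun h => hy (Fin.ext h.symm)
            simp [jordanMatrix, jordanBlock, Matrix.blockDiagonal'_apply_eq, this]
          · simp
        · rw [he0 _ _ (by have := hE' i; simp only; omega), Finset.sum_eq_zero]
          intro y _
          have : ¬ ((j : ℕ) + 1 = y) := fun h => hj (h ▸ y.2)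
          simp [jordanMatrix, jordanBlock, Matrix.blockDiagonal'_apply_eq, this]
      · intro y _ hy
        refine Finset.sum_eq_zero fun z _ => ?_
        simp [jordanMatrix, Matrix.blockDiagonal'_apply_ne _ _ _ hy.symm]
      · simp
    ext i j
    have := congrFun (key (eq.symm i)) j
    simpa using this
  refine ⟨L, eq, hT.unit⁻¹, ?_, ?_⟩
  · rw [hP]
    have : (Finset.univ : Finset I).val = (Finset.univ : Finset (Fin (Fintype.card I))).val.map E := by
      rw [← Finset.map_univ_equiv E]
      rfl
    rw [this, Multiset.map_map]
    simp [L, Fin.univ_val_map]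
  · have hinv : ((hT.unit⁻¹ : GL ι K) : Matrix ι ι K)⁻¹ = T := by
      rw [Matrix.coe_units_inv, IsUnit.unit_spec, Matrix.nonsing_inv_nonsing_inv]
      exact (Matrix.isUnit_iff_isUnit_det T).1 hT
    rw [hinv, hTB, Matrix.coe_units_inv, IsUnit.unit_spec, Matrix.mul_assoc, Matrix.mul_nonsing_inv,
      Matrix.mul_one]
    exact (Matrix.isUnit_iff_isUnit_det T).1 hT

/-! ### Toeplitz matrices and power series -/

section Toeplitz

open PowerSeries

variable {K : Type*} [Field K]

/-- The first `a` coefficients of a power series. -/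
noncomputable def truncVec (a : ℕ) (v : K⟦X⟧) : Fin a → K := fun i => coeff (i : ℕ) v

/-- The matrix of multiplication by `p` from `K[X]/(X^a)` to `K[X]/(X^b)` (acting on rows). -/
noncomputable def toeplitz (a b : ℕ) (p : K⟦X⟧) : Matrix (Fin a) (Fin b) K :=
  Matrix.of fun i j => if (i : ℕ) ≤ j then coeff ((j : ℕ) - i) p else 0

theorem truncVec_add (a : ℕ) (v w : K⟦X⟧) : truncVec a (v + w) = truncVec a v + truncVec a w := by
  ext i; simp [truncVec]

theorem truncVec_C_mul (a : ℕ) (s : K) (v : K⟦X⟧) : truncVec a (C s * v) = s • truncVec a v := by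
  ext i; simp [truncVec]

theorem truncVec_eq_zero_iff {a : ℕ} {v : K⟦X⟧} : truncVec a v = 0 ↔ X ^ a ∣ v := by
  rw [X_pow_dvd_iff]
  exact ⟨fun h i hi => congrFun h ⟨i, hi⟩, fun h => funext fun i => h i i.2⟩

theorem truncVec_eq_iff {a : ℕ} {v w : K⟦X⟧} : truncVec a v = truncVec a w ↔ X ^ a ∣ v - w := by
  rw [X_pow_dvd_iff]
  simp only [map_sub, sub_eq_zero]
  exact ⟨fun h i hi => congrFun h ⟨i, hi⟩, fun h => funext fun i => h i i.2⟩

theorem truncVec_surjective (a : ℕ) : Function.Surjective (truncVec (K := K) a) := fun f =>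
  ⟨PowerSeries.mk fun n => if h : n < a then f ⟨n, h⟩ else 0, by ext i; simp [truncVec]⟩

/-- The divisibility says that multiplication by `p` is well defined from `K[X]/(X^a)` to
`K[X]/(X^b)`. It kills the terms with `i ≥ a` of the Cauchy product, which the truncated vector does
not see. -/
theorem truncVec_vecMul_toeplitz {a b : ℕ} {p : K⟦X⟧} (hp : X ^ b ∣ X ^ a * p) (v : K⟦X⟧) :
    Matrix.vecMul (truncVec a v) (toeplitz a b p) = truncVec b (v * p) := by
  ext j
  have h0 : ∀ n, n + a < b → coeff n p = 0 := by
    intro n hn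
    have := X_pow_dvd_iff.1 hp (n + a) hn
    rwa [coeff_X_pow_mul] at this
  simp only [Matrix.vecMul, dotProduct, truncVec, toeplitz, Matrix.of_apply]
  rw [coeff_mul, Finset.Nat.sum_antidiagonal_eq_sum_range_succ
    (fun i l => coeff i v * coeff l p),
    Fin.sum_univ_eq_sum_range (fun i => coeff i v * if i ≤ (j : ℕ) then coeff ((j : ℕ) - i) p else 0)]
  trans ∑ i ∈ Finset.range a ∪ Finset.range (j + 1),
    coeff i v * if i ≤ (j : ℕ) then coeff ((j : ℕ) - i) p else 0
  · refine Finset.sum_subset Finset.subset_union_left fun i _ hi => ?_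
    rw [Finset.mem_range] at hi
    split_ifs
    · rw [h0 _ (by have := j.2; omega), mul_zero]
    · rw [mul_zero]
  · refine (Finset.sum_subset Finset.subset_union_right fun i _ hi => ?_).symm.trans
      (Finset.sum_congr rfl fun i hi => ?_)
    · rw [if_neg (by rw [Finset.mem_range] at hi; omega), mul_zero]
    · rw [if_pos (by rw [Finset.mem_range] at hi; omega)]

theorem toeplitz_add (a b : ℕ) (p q : K⟦X⟧) :
    toeplitz a b (p + q) = toeplitz a b p + toeplitz a b q := by
  ext i j
  simp only [toeplitz, Matrix.of_apply, Matrix.add_apply]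
  split_ifs <;> simp

theorem toeplitz_C_mul (a b : ℕ) (s : K) (p : K⟦X⟧) :
    toeplitz a b (C s * p) = s • toeplitz a b p := by
  ext i j
  simp only [toeplitz, Matrix.of_apply, Matrix.smul_apply]
  split_ifs <;> simp

theorem toeplitz_X (n : ℕ) : toeplitz n n (X : K⟦X⟧) = jordanBlock K n := by
  ext i j
  simp only [toeplitz, jordanBlock, Matrix.of_apply, coeff_X]
  split_ifs <;> first | rfl | omega

theorem toeplitz_zero (a b : ℕ) : toeplitz a b (0 : K⟦X⟧) = 0 := by
  ext i j
  simp [toeplitz]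

/-- A matrix intertwining two nilpotent Jordan blocks is a Toeplitz matrix. -/
theorem eq_toeplitz_of_intertwines {a b : ℕ} (ha : 0 < a) {M : Matrix (Fin a) (Fin b) K}
    (h : M * jordanBlock K b = jordanBlock K a * M) :
    ∃ p : K⟦X⟧, X ^ b ∣ X ^ a * p ∧ M = toeplitz a b p ∧ ∀ n, b ≤ n → coeff n p = 0 := by
  have hl : ∀ (i : Fin a) (j : Fin b), (M * jordanBlock K b) i j =
      if h : 0 < (j : ℕ) then M i ⟨j - 1, by omega⟩ else 0 := by
    intro i j
    simp only [Matrix.mul_apply, jordanBlock, Matrix.of_apply, mul_ite, mul_one, mul_zero]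
    split_ifs with hj
    · rw [Finset.sum_eq_single (⟨j - 1, by omega⟩ : Fin b), if_pos (by simp only; omega)]
      · intro y _ hy
        exact if_neg fun h => hy (Fin.ext (by simp only; omega))
      · simp
    · exact Finset.sum_eq_zero fun y _ => if_neg (by omega)
  have hr : ∀ (i : Fin a) (j : Fin b), (jordanBlock K a * M) i j =
      if h : (i : ℕ) + 1 < a then M ⟨i + 1, h⟩ j else 0 := by
    intro i j
    simp only [Matrix.mul_apply, jordanBlock, Matrix.of_apply, ite_mul, one_mul, zero_mul]
    split_ifs with hi
    · rw [Finset.sum_eq_single (⟨i + 1, hi⟩ : Fin a), if_pos rfl]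
      · intro y _ hy
        exact if_neg fun h => hy (Fin.ext h.symm)
      · simp
    · exact Finset.sum_eq_zero fun y _ => if_neg (by omega)
  -- Entries are constant along diagonals, and the shift past the last row or first column gives
  -- zeros. The last row yields the divisibility claim.
  have key : ∀ (i : Fin a) (j : Fin b), (if h : 0 < (j : ℕ) then M i ⟨j - 1, by omega⟩ else 0) =
      if h : (i : ℕ) + 1 < a then M ⟨i + 1, h⟩ j else 0 := by
    intro i j
    rw [← hl, ← hr, h]
  let p : K⟦X⟧ := PowerSeries.mk fun n => if h : n < b then M ⟨0, ha⟩ ⟨n, h⟩ else 0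
  have hM : ∀ (i : ℕ) (hi : i < a) (j : ℕ) (hj : j < b),
      M ⟨i, hi⟩ ⟨j, hj⟩ = if i ≤ j then coeff (j - i) p else 0 := by
    intro i
    induction i with
    | zero => intro hi j hj; simp [p, hj]
    | succ i ih =>
      intro hi j hj
      have := key ⟨i, by omega⟩ ⟨j, hj⟩
      simp only [dif_pos hi] at this
      rw [← this]
      split_ifs with h1 h2 h2
      · rw [ih, if_pos (by omega)]
        congr 2
        omega
      · rw [ih, if_neg (by omega)]
      · omega
      · rfl
  refine ⟨p, ?_, Matrix.ext fun i j => hM i i.2 j j.2, ?_⟩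
  · rw [X_pow_dvd_iff]
    intro n hn
    rw [coeff_X_pow_mul']
    split_ifs with hna
    · have h1 := key ⟨a - 1, by omega⟩ ⟨n, hn⟩
      rw [dif_pos (show 0 < n by omega), dif_neg (show ¬ a - 1 + 1 < a by omega), hM,
        if_pos (show a - 1 ≤ n - 1 by omega)] at h1
      rw [← h1, show n - 1 - (a - 1) = n - a by omega]
    · rfl
  · intro n hn
    simp [p, Nat.not_lt.2 hn]

end Toeplitz

/-! ### The nilpotent commutator in terms of power series -/

section Commutator

open PowerSeries

variable {K : Type*} [Field K]

/-- A row vector of `K[X]/(X^u) ⊕ K[X]/(X^t)`. -/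
noncomputable def pairVec (u t : ℕ) (v w : K⟦X⟧) : Fin u ⊕ Fin t → K :=
  Sum.elim (truncVec u v) (truncVec t w)

/-- The matrix of the endomorphism `(v, w) ↦ (v p + w p', v q + w q')` of
`K[X]/(X^u) ⊕ K[X]/(X^t)`. -/
noncomputable def pairMatrix (u t : ℕ) (p q p' q' : K⟦X⟧) :
    Matrix (Fin u ⊕ Fin t) (Fin u ⊕ Fin t) K :=
  Matrix.fromBlocks (toeplitz u u p) (toeplitz u t q) (toeplitz t u p') (toeplitz t t q')

theorem pairVec_surjective (u t : ℕ) (x : Fin u ⊕ Fin t → K) : ∃ v w, pairVec u t v w = x := by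
  obtain ⟨v, hv⟩ := truncVec_surjective u (x ∘ Sum.inl)
  obtain ⟨w, hw⟩ := truncVec_surjective t (x ∘ Sum.inr)
  exact ⟨v, w, by rw [pairVec, hv, hw, Sum.elim_comp_inl_inr]⟩

theorem pairVec_eq_iff {u t : ℕ} {v w v' w' : K⟦X⟧} :
    pairVec u t v w = pairVec u t v' w' ↔ X ^ u ∣ v - v' ∧ X ^ t ∣ w - w' := by
  rw [← truncVec_eq_iff, ← truncVec_eq_iff, pairVec, pairVec]
  constructor
  · intro h
    exact ⟨funext fun i => congrFun h (Sum.inl i), funext fun i => congrFun h (Sum.inr i)⟩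
  · rintro ⟨h, h'⟩
    rw [h, h']

theorem pairVec_zero (u t : ℕ) : pairVec u t (0 : K⟦X⟧) 0 = 0 := by
  ext (i | i) <;> simp [pairVec, truncVec]

theorem pairVec_C_mul (u t : ℕ) (s : K) (v w : K⟦X⟧) :
    pairVec u t (C s * v) (C s * w) = s • pairVec u t v w := by
  ext (i | i) <;> simp [pairVec, truncVec]

theorem pairVec_vecMul {u t : ℕ} (htu : t ≤ u) {p q p' q' : K⟦X⟧} (hp' : X ^ u ∣ X ^ t * p')
    (v w : K⟦X⟧) : Matrix.vecMul (pairVec u t v w) (pairMatrix u t p q p' q') =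
      pairVec u t (v * p + w * p') (v * q + w * q') := by
  rw [pairMatrix, Matrix.vecMul_fromBlocks]
  simp only [pairVec, Sum.elim_comp_inl, Sum.elim_comp_inr]
  rw [truncVec_vecMul_toeplitz (dvd_mul_right _ _), truncVec_vecMul_toeplitz hp',
    truncVec_vecMul_toeplitz ((pow_dvd_pow _ htu).mul_right _),
    truncVec_vecMul_toeplitz (dvd_mul_right _ _), truncVec_add, truncVec_add]

theorem matrix_ext_vecMul_pairVec {u t : ℕ} {ι : Type*} {M N : Matrix (Fin u ⊕ Fin t) ι K}
    (h : ∀ v w, Matrix.vecMul (pairVec u t v w) M = Matrix.vecMul (pairVec u t v w) N) :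
    M = N := by
  refine Matrix.ext_of_single_vecMul fun i => ?_
  obtain ⟨v, w, hvw⟩ := pairVec_surjective u t (Pi.single i (1 : K))
  rw [← hvw, h]

theorem jordanQ_eq_pairMatrix (u r : ℕ) :
    jordanQ K u r = pairMatrix u (u - r) X 0 0 X := by
  rw [jordanQ, pairMatrix, toeplitz_X, toeplitz_X, toeplitz_zero, toeplitz_zero]

theorem pairMatrix_commute {u r : ℕ} (p q p' q' : K⟦X⟧) (hp' : X ^ u ∣ X ^ (u - r) * p') :
    pairMatrix u (u - r) p q p' q' * jordanQ K u r =
      jordanQ K u r * pairMatrix u (u - r) p q p' q' := by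
  rw [jordanQ_eq_pairMatrix]
  refine matrix_ext_vecMul_pairVec fun v w => ?_
  rw [← Matrix.vecMul_vecMul, ← Matrix.vecMul_vecMul, pairVec_vecMul (Nat.sub_le _ _) hp',
    pairVec_vecMul (Nat.sub_le _ _) (by simp), pairVec_vecMul (Nat.sub_le _ _) (by simp),
    pairVec_vecMul (Nat.sub_le _ _) hp']
  congr 1 <;> ring

theorem exists_pairMatrix_of_commute {u r : ℕ} (hru : r < u) {B : BlockMatrix K u r}
    (h : B * jordanQ K u r = jordanQ K u r * B) :
    ∃ p q p' q' : K⟦X⟧, B = pairMatrix u (u - r) p q (X ^ r * p') q' ∧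
      ∀ n, u - r ≤ n → coeff n q' = 0 := by
  rw [← Matrix.fromBlocks_toBlocks B, jordanQ, Matrix.fromBlocks_multiply,
    Matrix.fromBlocks_multiply, Matrix.fromBlocks_inj] at h
  simp only [Matrix.mul_zero, Matrix.zero_mul, add_zero, zero_add] at h
  obtain ⟨p, -, hp, -⟩ := eq_toeplitz_of_intertwines (by omega) h.1
  obtain ⟨q, -, hq, -⟩ := eq_toeplitz_of_intertwines (by omega) h.2.1
  obtain ⟨p', ⟨z, hz⟩, hp', -⟩ := eq_toeplitz_of_intertwines (by omega) h.2.2.1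
  obtain ⟨q', -, hq', h0⟩ := eq_toeplitz_of_intertwines (by omega) h.2.2.2
  have hz' : p' = X ^ r * z := by
    have : (X : K⟦X⟧) ^ (u - r) ≠ 0 := pow_ne_zero _ X_ne_zero
    refine mul_left_cancel₀ this ?_
    rw [hz, ← mul_assoc, ← pow_add, Nat.sub_add_cancel hru.le]
  refine ⟨p, q, z, q', ?_, h0⟩
  rw [← Matrix.fromBlocks_toBlocks B, hp, hq, hp', hq', hz', pairMatrix]

theorem eq_zero_of_vecMul_eq_smul {ι : Type*} [Fintype ι] [DecidableEq ι] {B : Matrix ι ι K}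
    (hB : IsNilpotent B) {v : ι → K} {s : K} (h : Matrix.vecMul v B = s • v) (hv : v ≠ 0) :
    s = 0 := by
  obtain ⟨n, hn⟩ := hB
  have key : ∀ n : ℕ, Matrix.vecMul v (B ^ n) = s ^ n • v := by
    intro n
    induction n with
    | zero => simp
    | succ n ih => rw [pow_succ, ← Matrix.vecMul_vecMul, ih, Matrix.smul_vecMul, h, smul_smul,
        pow_succ]
  have := key n
  rw [hn, Matrix.vecMul_zero] at this
  exact IsNilpotent.eq_zero ⟨n, (smul_eq_zero.1 this.symm).resolve_right hv⟩

theorem X_dvd_sub_C_constantCoeff (p : K⟦X⟧) : X ∣ p - C (constantCoeff p) := by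
  rw [X_dvd_iff]
  simp

theorem X_dvd_of_isNilpotent_pairMatrix {u r : ℕ} (hr : 0 < r) (hru : r < u)
    {p q p' q' : K⟦X⟧} (hB : IsNilpotent (pairMatrix u (u - r) p q (X ^ r * p') q')) :
    X ∣ p ∧ X ∣ q' := by
  have hdvd : (X : K⟦X⟧) ^ u ∣ X ^ (u - r) * (X ^ r * p') := by
    rw [← mul_assoc, ← pow_add, Nat.sub_add_cancel hru.le]
    exact dvd_mul_right _ _
  have htu : u - r ≤ u := Nat.sub_le _ _
  have hu : (X : K⟦X⟧) ^ u = X ^ (u - 1) * X := by rw [← pow_succ, Nat.sub_add_cancel (by omega)]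
  have ht : (X : K⟦X⟧) ^ (u - r) = X ^ (u - r - 1) * X := by
    rw [← pow_succ, Nat.sub_add_cancel (by omega)]
  have htu' : (X : K⟦X⟧) ^ (u - r) ∣ X ^ (u - 1) := pow_dvd_pow _ (by omega)
  have hX : ∀ n : ℕ, ¬ (X : K⟦X⟧) ^ n * X ∣ X ^ n := by
    intro n h
    rw [← pow_succ] at h
    have := X_pow_dvd_iff.1 h n (by omega)
    simp [coeff_X_pow] at this
  obtain ⟨z, hz⟩ := X_dvd_sub_C_constantCoeff p
  obtain ⟨z', hz'⟩ := X_dvd_sub_C_constantCoeff q'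
  have hp : X ∣ p := by
    rw [X_dvd_iff]
    -- `(X^(u-1), 0)` is an eigenvector with eigenvalue `p(0)`: its second component is killed
    -- because `u - r ≤ u - 1`.
    refine eq_zero_of_vecMul_eq_smul hB (v := pairVec u (u - r) (X ^ (u - 1)) 0) ?_ ?_
    · rw [pairVec_vecMul htu hdvd, ← pairVec_C_mul, pairVec_eq_iff]
      refine ⟨⟨z, ?_⟩, ?_⟩
      · rw [hu]
        linear_combination X ^ (u - 1) * hz
      · simpa using htu'.mul_right q
    · intro h
      rw [← pairVec_zero, pairVec_eq_iff, hu, sub_zero] at h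
      exact hX _ h.1
  refine ⟨hp, ?_⟩
  obtain ⟨y, rfl⟩ := hp
  by_contra hne
  rw [X_dvd_iff] at hne
  -- The eigenvector for `q'(0)` is the image of `(0, X^(u-r-1))`. That vector itself may acquire a
  -- first component `X^(u-1) p'`, which the next application kills since `X ∣ p`.
  refine hne (eq_zero_of_vecMul_eq_smul hB (v := pairVec u (u - r)
    (X ^ (u - r - 1) * (X ^ r * p')) (X ^ (u - r - 1) * q')) ?_ ?_)
  · have h1 : (X : K⟦X⟧) ^ (u - r - 1) * X ^ r = X ^ (u - 1) := by
      rw [← pow_add]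
      congr 1
      omega
    rw [pairVec_vecMul htu hdvd, ← pairVec_C_mul, pairVec_eq_iff]
    constructor
    · refine ⟨p' * y + p' * z', ?_⟩
      rw [hu, ← h1]
      linear_combination X ^ (u - r - 1) * X ^ r * p' * hz'
    · have h2 : (X : K⟦X⟧) ^ (u - r - 1) * (X ^ r * p') * q + X ^ (u - r - 1) * q' * q' -
          C (constantCoeff q') * (X ^ (u - r - 1) * q') =
          X ^ (u - 1) * (p' * q) + X ^ (u - r) * (z' * q') := by
        rw [ht, ← h1]
        linear_combination X ^ (u - r - 1) * q' * hz'
      rw [h2]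
      exact dvd_add (htu'.mul_right _) (dvd_mul_right _ _)
  · intro h
    rw [← pairVec_zero, pairVec_eq_iff, ht, sub_zero, sub_zero] at h
    obtain ⟨w, hw⟩ := h.2
    have : q' = X * w := by
      refine mul_left_cancel₀ (pow_ne_zero (u - r - 1) (X_ne_zero (R := K))) ?_
      rw [hw]; ring
    exact hne (by simp [this])

/-- The matrices parametrising the locus. -/
noncomputable def locusMatrix (u r k : ℕ) (a g h b : K⟦X⟧) : BlockMatrix K u r :=
  pairMatrix u (u - r) (X ^ k * a) g (X ^ r * h) (X ^ (r - k) * b)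

theorem X_pow_dvd_X_pow_sub_mul {u r : ℕ} (hru : r < u) (p : K⟦X⟧) :
    (X : K⟦X⟧) ^ u ∣ X ^ (u - r) * (X ^ r * p) := by
  rw [← mul_assoc, ← pow_add, Nat.sub_add_cancel hru.le]
  exact dvd_mul_right _ _

/-- Modulo `X` only the entry `g` survives, so the square is divisible by `X` and the `2u`-th power
vanishes. -/
theorem isNilpotent_locusMatrix {u r k : ℕ} (hru : r < u) (hk : 1 ≤ k) (hkr : k ≤ r - 1)
    (a g h b : K⟦X⟧) : IsNilpotent (locusMatrix u r k a g h b) := by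
  have hX : ∀ n : ℕ, 0 < n → (X : K⟦X⟧) ^ n = X * X ^ (n - 1) := by
    intro n hn
    rw [← pow_succ', Nat.sub_add_cancel hn]
  have key : ∀ (n : ℕ) (v w : K⟦X⟧), ∃ v' w', Matrix.vecMul (pairVec u (u - r) v w)
      (locusMatrix u r k a g h b ^ (2 * n)) = pairVec u (u - r) (X ^ n * v') (X ^ n * w') := by
    intro n v w
    induction n with
    | zero => exact ⟨v, w, by simp⟩
    | succ n ih =>
      obtain ⟨v', w', ih⟩ := ih
      rw [show 2 * (n + 1) = 2 * n + 1 + 1 by ring, pow_succ, pow_succ, ← Matrix.vecMul_vecMul,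
        ← Matrix.vecMul_vecMul, ih, locusMatrix,
        pairVec_vecMul (Nat.sub_le _ _) (X_pow_dvd_X_pow_sub_mul hru h),
        pairVec_vecMul (Nat.sub_le _ _) (X_pow_dvd_X_pow_sub_mul hru h),
        hX k hk, hX r (by omega), hX (r - k) (by omega)]
      refine ⟨(v' * (X * X ^ (k - 1) * a) + w' * (X * X ^ (r - 1) * h)) * (X ^ (k - 1) * a) +
        (v' * g + w' * (X * X ^ (r - k - 1) * b)) * (X ^ (r - 1) * h),
        (v' * (X ^ (k - 1) * a) + w' * (X ^ (r - 1) * h)) * g +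
        (v' * g + w' * (X * X ^ (r - k - 1) * b)) * (X ^ (r - k - 1) * b), ?_⟩
      congr 1 <;> ring
  refine ⟨2 * u, matrix_ext_vecMul_pairVec fun v w => ?_⟩
  obtain ⟨v', w', h'⟩ := key u v w
  rw [h', Matrix.vecMul_zero, ← pairVec_zero, pairVec_eq_iff, sub_zero, sub_zero]
  exact ⟨dvd_mul_right _ _, (pow_dvd_pow _ (Nat.sub_le _ _)).mul_right _⟩

theorem coordA_pairMatrix {u r : ℕ} (p q p' q' : K⟦X⟧) {i : ℕ} (hi : i < u) :
    coordA (pairMatrix u (u - r) p q p' q' : BlockMatrix K u r) i = coeff i p := by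
  simp [coordA, hi, pairMatrix, toeplitz]

theorem coordB_pairMatrix {u r : ℕ} (p q p' q' : K⟦X⟧) {i : ℕ} (hi : i < u - r) :
    coordB (pairMatrix u (u - r) p q p' q' : BlockMatrix K u r) i = coeff i q' := by
  simp [coordB, hi, pairMatrix, toeplitz]

theorem coordG_pairMatrix {u r : ℕ} (p q p' q' : K⟦X⟧) {i : ℕ} (hi : i < u - r) :
    coordG (pairMatrix u (u - r) p q p' q' : BlockMatrix K u r) i = coeff i q := by
  simp [coordG, hi, pairMatrix, toeplitz]

theorem coordH_pairMatrix {u r : ℕ} (p q p' q' : K⟦X⟧) {i : ℕ} (hi : i < u - r) :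
    coordH (pairMatrix u (u - r) p q (X ^ r * p') q' : BlockMatrix K u r) i = coeff i p' := by
  simp [coordH, hi, pairMatrix, toeplitz, add_comm r i, coeff_X_pow_mul]

theorem sum_coord_locusMatrix {u r k : ℕ} (hkr : k ≤ r - 1) (a g h b : K⟦X⟧) {s : ℕ}
    (hs : s < k + (u - r) - r) :
    ∑ j ∈ Finset.range (s + 1), (coordA (locusMatrix u r k a g h b) (k + j) *
      coordB (locusMatrix u r k a g h b) (r - k + (s - j)) -
      coordG (locusMatrix u r k a g h b) j * coordH (locusMatrix u r k a g h b) (s - j)) =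
    coeff s (a * b - g * h) := by
  rw [map_sub, coeff_mul, coeff_mul, ← Finset.sum_sub_distrib,
    Finset.Nat.sum_antidiagonal_eq_sum_range_succ
      (fun i j => coeff i a * coeff j b - coeff i g * coeff j h)]
  refine Finset.sum_congr rfl fun j hj => ?_
  rw [Finset.mem_range] at hj
  rw [locusMatrix, coordA_pairMatrix _ _ _ _ (by omega), coordB_pairMatrix _ _ _ _ (by omega),
    coordG_pairMatrix _ _ _ _ (by omega), coordH_pairMatrix _ _ _ _ (by omega),
    add_comm k j, coeff_X_pow_mul, add_comm (r - k), coeff_X_pow_mul]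

/-- The exponent is a truncated difference: it is `0` when `k + (u - r) ≤ r`, so one divisibility
covers both cases of the definition. -/
theorem mem_locusX_iff {u r k : ℕ} (hru : r < u) (hk : 1 ≤ k) (hkr : k ≤ r - 1)
    {B : BlockMatrix K u r} : B ∈ locusX K u r k (u - r) ↔
      ∃ a g h b : K⟦X⟧, B = locusMatrix u r k a g h b ∧
        X ^ (k + (u - r) - r) ∣ a * b - g * h := by
  constructor
  · rintro ⟨⟨hnil, hcomm⟩, hA, hB1, hB2⟩
    obtain ⟨p, g, h, q', rfl, hq'⟩ := exists_pairMatrix_of_commute hru hcomm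
    obtain ⟨hp0, hq0⟩ := X_dvd_of_isNilpotent_pairMatrix (by omega) hru hnil
    rw [X_dvd_iff, ← coeff_zero_eq_constantCoeff_apply] at hp0 hq0
    obtain ⟨a, rfl⟩ : X ^ k ∣ p := by
      rw [X_pow_dvd_iff]
      intro m hm
      rcases Nat.eq_zero_or_pos m with rfl | hm0
      · exact hp0
      · have := hA m hm0 (by omega)
        rwa [coordA_pairMatrix _ _ _ _ (by omega)] at this
    obtain ⟨b, rfl⟩ : X ^ (r - k) ∣ q' := by
      rw [X_pow_dvd_iff]
      intro m hm
      rcases Nat.eq_zero_or_pos m with rfl | hm0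
      · exact hq0
      · by_cases hmt : m < u - r
        · rw [← coordB_pairMatrix (r := r) (X ^ k * a) g (X ^ r * h) q' hmt]
          rcases le_or_gt (k + (u - r)) r with hle | hlt
          · exact hB1 hle m hm0 (by omega)
          · exact (hB2 hlt).1 m hm0 (by omega)
        -- Beyond the range of the coordinates, `q'` was chosen with zero coefficients; this matters
        -- when `r - k > u - r`.
        · exact hq' m (by omega)
    refine ⟨a, g, h, b, rfl, ?_⟩
    rw [X_pow_dvd_iff]
    intro s hs
    rw [← sum_coord_locusMatrix hkr a g h b hs]
    exact (hB2 (by omega)).2 s (by omega)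
  · rintro ⟨a, g, h, b, rfl, hdvd⟩
    refine ⟨⟨isNilpotent_locusMatrix hru hk hkr a g h b,
      pairMatrix_commute _ _ _ _ (X_pow_dvd_X_pow_sub_mul hru h)⟩, ?_, ?_, ?_⟩
    · intro i _ hi
      rw [locusMatrix, coordA_pairMatrix _ _ _ _ (by omega), coeff_X_pow_mul', if_neg (by omega)]
    · intro hle i _ hi
      rw [locusMatrix, coordB_pairMatrix _ _ _ _ (by omega), coeff_X_pow_mul', if_neg (by omega)]
    · intro hlt
      refine ⟨?_, ?_⟩
      · intro i _ hi
        rw [locusMatrix, coordB_pairMatrix _ _ _ _ (by omega), coeff_X_pow_mul',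
          if_neg (by omega)]
      · intro s hs
        rw [sum_coord_locusMatrix hkr a g h b (by omega)]
        exact X_pow_dvd_iff.1 hdvd s (by omega)

end Commutator

/-! ### The Jordan type of a generic element -/

section JordanType

open PowerSeries

variable {K : Type*} [Field K]

/-- This matches the length of the `i`-th chain with the exponents `c - 1 - i + c * j` that lie
below `d`. -/
theorem lt_balanced_iff {c d i j : ℕ} (hi : i < c) :
    j < (d + i) / c ↔ c - 1 - i + c * j < d := by
  rw [← Nat.succ_le_iff, Nat.le_div_iff_mul_le (by omega), Nat.succ_mul, mul_comm j]
  omega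

/-- The vectors `X^(c-1-i) * (X^c w)^j` span `K[X]/(X^d)` if `w` is a unit. -/
theorem span_truncVec_chain {c d : ℕ} (hc : 0 < c) {w : K⟦X⟧} (hw : constantCoeff w ≠ 0) :
    ⊤ ≤ Submodule.span K (Set.range fun x : (i : Fin c) × Fin ((d + i) / c) =>
      truncVec d (X ^ (c - 1 - (x.1 : ℕ)) * (X ^ c * w) ^ (x.2 : ℕ))) := by
  set S := Submodule.span K (Set.range fun x : (i : Fin c) × Fin ((d + i) / c) =>
      truncVec d (X ^ (c - 1 - (x.1 : ℕ)) * (X ^ c * w) ^ (x.2 : ℕ))) with hS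
  -- Division by `c` shows that each order `n < d` is attained by a chain vector. Subtracting a
  -- multiple of it raises the order, until `X^d` is reached.
  have key : ∀ m n, d ≤ n + m → ∀ p, truncVec d (X ^ n * p) ∈ S := by
    intro m
    induction m with
    | zero =>
      intro n hn p
      rw [truncVec_eq_zero_iff.2 ((pow_dvd_pow X (by omega)).mul_right p)]
      exact S.zero_mem
    | succ m ih =>
      intro n hn p
      by_cases hnd : n < d
      · have hmod := Nat.mod_lt n hc
        have hdiv := Nat.mod_add_div n c
        have hi : c - 1 - n % c < c := by omega
        have hn' : c - 1 - (c - 1 - n % c) + c * (n / c) = n := by omega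
        have hmem : truncVec d (X ^ n * w ^ (n / c)) ∈ S := by
          refine Submodule.subset_span ⟨⟨⟨c - 1 - n % c, hi⟩,
            ⟨n / c, (lt_balanced_iff hi).2 (by omega)⟩⟩, ?_⟩
          simp only
          congr 1
          rw [mul_pow, ← mul_assoc, ← pow_mul, ← pow_add, hn']
        set s := constantCoeff p / constantCoeff (w ^ (n / c)) with hs
        have hs' : s * constantCoeff w ^ (n / c) = constantCoeff p := by
          rw [hs, map_pow, div_mul_cancel₀ _ (pow_ne_zero _ hw)]
        obtain ⟨q, hq⟩ : X ∣ p - C s * w ^ (n / c) := by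
          rw [X_dvd_iff]
          simp [hs']
        have hp : X ^ n * p = C s * (X ^ n * w ^ (n / c)) + X ^ (n + 1) * q := by
          rw [pow_succ]
          linear_combination X ^ n * hq
        rw [hp, truncVec_add, truncVec_C_mul]
        exact S.add_mem (S.smul_mem _ hmem) (ih (n + 1) (by omega) q)
      · exact ih n (by omega) p
  intro x _
  obtain ⟨p, rfl⟩ := truncVec_surjective d x
  simpa using key d 0 (by omega) p

theorem balanced_eq_univ_map (c d : ℕ) :
    balanced c d = (Finset.univ : Finset (Fin c)).val.map fun i : Fin c => (d + (i : ℕ)) / c := by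
  rw [balanced, Fin.univ_val_map, List.ofFn_eq_map, Multiset.range, Multiset.map_coe,
    ← List.map_coe_finRange_eq_range, List.map_map]
  rfl

theorem sum_fin_balanced {c : ℕ} (hc : 0 < c) (d : ℕ) :
    ∑ i : Fin c, (d + (i : ℕ)) / c = d := by
  have := sum_balanced hc d
  rwa [balanced_eq_univ_map] at this

theorem exists_truncVec_basis {c d : ℕ} (hc : 0 < c) {w : K⟦X⟧} (hw : constantCoeff w ≠ 0) :
    ∃ b : Module.Basis ((i : Fin c) × Fin ((d + i) / c)) K (Fin d → K),
      ∀ x, b x = truncVec d (X ^ (c - 1 - (x.1 : ℕ)) * (X ^ c * w) ^ (x.2 : ℕ)) := by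
  refine ⟨basisOfTopLeSpanOfCardEqFinrank _ (span_truncVec_chain hc hw) ?_, fun x => ?_⟩
  · rw [Fintype.card_sigma, Module.finrank_fin_fun]
    simpa using sum_fin_balanced hc d
  · rw [coe_basisOfTopLeSpanOfCardEqFinrank]

/-- The Jordan type of a matrix `locusMatrix u r k a g (c * a) b` whose determinant vanishes. -/
theorem hasJordanType_locusMatrix {u r k : ℕ} (hru : r < u) (hkr : k ≤ r - 1)
    {P : (u + (u - r)).Partition} {m : ℕ} (hm : 0 < m) (hmu : m ≤ u - k)
    (hmk : m ≤ u - r + k)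
    (hP : P.parts = balanced m (u - k + m) + Multiset.replicate (u - r + k - m) 1)
    {a g c b w : K⟦X⟧} (ha : constantCoeff a ≠ 0) (hw : constantCoeff w ≠ 0)
    (hy : X ^ k * a + X ^ (r - k) * c * g = X ^ m * w)
    (hb : X ^ (k + (u - r) - r) ∣ b - g * c) :
    HasJordanType (locusMatrix u r k a g (c * a) b) P := by
  set d := u - k with hd
  -- `Φ` sends `(v, w)` to `v + w X^(r-k) c`, and `Ψ` sends `v` to `(v X^k a, v g)`. Hence `Ψ`
  -- followed by `Φ` is multiplication by `X^m w`, with the `w` of `hy`.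
  let Φ : Matrix (Fin u ⊕ Fin (u - r)) (Fin d) K :=
    Matrix.fromRows (toeplitz u d 1) (toeplitz (u - r) d (X ^ (r - k) * c))
  let Ψ : Matrix (Fin d) (Fin u ⊕ Fin (u - r)) K :=
    Matrix.fromCols (toeplitz d u (X ^ k * a)) (toeplitz d (u - r) g)
  have hΦ : ∀ v w, Matrix.vecMul (pairVec u (u - r) v w) Φ =
      truncVec d (v + w * (X ^ (r - k) * c)) := by
    intro v w
    rw [pairVec, Matrix.sumElim_vecMul_fromRows, truncVec_vecMul_toeplitz,
      truncVec_vecMul_toeplitz, ← truncVec_add, mul_one]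
    · rw [← mul_assoc, ← pow_add]
      exact (pow_dvd_pow _ (by omega)).mul_right _
    · exact (pow_dvd_pow _ (by omega)).mul_right _
  have hΨ : ∀ v, Matrix.vecMul (truncVec d v) Ψ = pairVec u (u - r) (v * (X ^ k * a)) (v * g) := by
    intro v
    rw [Matrix.vecMul_fromCols, truncVec_vecMul_toeplitz, truncVec_vecMul_toeplitz, pairVec]
    · exact (pow_dvd_pow _ (by omega)).mul_right _
    · rw [← mul_assoc, ← pow_add]
      exact (pow_dvd_pow _ (by omega)).mul_right _
  have hB : locusMatrix u r k a g (c * a) b = Φ * Ψ := by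
    refine matrix_ext_vecMul_pairVec fun v w => ?_
    rw [← Matrix.vecMul_vecMul, hΦ, hΨ, locusMatrix,
      pairVec_vecMul (Nat.sub_le _ _) (X_pow_dvd_X_pow_sub_mul hru _), pairVec_eq_iff]
    have hX : (X : K⟦X⟧) ^ r = X ^ (r - k) * X ^ k := by
      rw [← pow_add, Nat.sub_add_cancel (by omega)]
    constructor
    · rw [hX]
      convert dvd_zero _ using 1
      ring
    · obtain ⟨z, hz⟩ := hb
      have : v * g + w * (X ^ (r - k) * b) - (v + w * (X ^ (r - k) * c)) * g =
          X ^ (r - k + (k + (u - r) - r)) * (w * z) := by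
        rw [pow_add]
        linear_combination w * X ^ (r - k) * hz
      rw [this]
      exact (pow_dvd_pow _ (by omega)).mul_right _
  let φ := Matrix.vecMulLinear (R := K) Φ
  let ψ := Matrix.vecMulLinear (R := K) Ψ
  have hφ : Function.Surjective φ := by
    intro x
    obtain ⟨p, rfl⟩ := truncVec_surjective d x
    refine ⟨pairVec u (u - r) p 0, ?_⟩
    change Matrix.vecMul _ Φ = _
    rw [hΦ, zero_mul, add_zero]
  have hψ : Function.Injective ψ := by
    rw [injective_iff_map_eq_zero]
    intro x hx
    obtain ⟨p, rfl⟩ := truncVec_surjective d x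
    change Matrix.vecMul _ Ψ = _ at hx
    rw [hΨ, ← pairVec_zero, pairVec_eq_iff, sub_zero] at hx
    rw [truncVec_eq_zero_iff]
    have hau : IsUnit a := isUnit_iff_constantCoeff.2 (isUnit_iff_ne_zero.2 ha)
    have h1 := hx.1
    rw [show p * (X ^ k * a) = X ^ k * p * a by ring, hau.dvd_mul_right,
      show u = k + d by omega, pow_add] at h1
    exact (mul_dvd_mul_iff_left (pow_ne_zero _ X_ne_zero)).1 h1
  obtain ⟨b₀, hb₀⟩ := exists_truncVec_basis (d := d) hm hw
  have hl : ∀ i : Fin m, 0 < (d + (i : ℕ)) / m := fun i => Nat.div_pos (by omega) hm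
  obtain ⟨b', e', hb', he0', he'⟩ := exists_jordan_basis φ ψ hφ hψ
    (fun i : Fin m => (d + (i : ℕ)) / m) hl b₀
    (fun i j => truncVec d (X ^ (m - 1 - (i : ℕ)) * (X ^ m * w) ^ j)) (fun i j => hb₀ ⟨i, j⟩)
    (by
      intro i j hij
      rw [truncVec_eq_zero_iff, mul_pow, ← mul_assoc, ← pow_mul, ← pow_add]
      have := (lt_balanced_iff (d := d) (j := j) i.2).not.1 (not_lt.2 hij)
      exact (pow_dvd_pow _ (by omega)).mul_right _)
    (by
      intro i j
      change Matrix.vecMul (Matrix.vecMul _ Ψ) Φ = _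
      rw [hΨ, hΦ]
      congr 1
      rw [pow_succ, ← hy]
      ring)
    (u - r + k - m) (by
      rw [Module.finrank_fin_fun, Module.finrank_fintype_fun_eq_card, Fintype.card_sum,
        Fintype.card_fin, Fintype.card_fin, Fintype.card_fin]
      omega)
  refine hasJordanType_of_basis _ b' e' hb' he0' ?_ ?_
  · intro i j
    rw [hB, ← Matrix.vecMul_vecMul]
    exact he' i j
  · have huniv : (Finset.univ : Finset (Fin m ⊕ Fin (u - r + k - m))).val =
        (Finset.univ : Finset (Fin m)).val.map Sum.inl +
          (Finset.univ : Finset (Fin (u - r + k - m))).val.map Sum.inr := rfl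
    rw [hP, balanced_add_self hm, balanced_eq_univ_map, huniv, Multiset.map_add, Multiset.map_map,
      Multiset.map_map, Multiset.map_map]
    congr 1
    change _ = Multiset.map (fun _ => 1) (Finset.univ : Finset (Fin (u - r + k - m))).val
    simp

/-- The Jordan type of a generic element of the locus. -/
theorem hasJordanType_of_generic {u r k : ℕ} (hru : r < u) (hk : 1 ≤ k) (hkr : k ≤ r - 1)
    {P : (u + (u - r)).Partition}
    (hP : P.parts = balanced (min k (r - k)) (u - k + min k (r - k)) +
      Multiset.replicate (u - r + k - min k (r - k)) 1)
    {a g h b : K⟦X⟧} (hdvd : X ^ (k + (u - r) - r) ∣ a * b - g * h)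
    (ha : constantCoeff a ≠ 0) (hgh : constantCoeff g * constantCoeff h ≠ 0)
    (hagh : constantCoeff a ^ 2 + constantCoeff g * constantCoeff h ≠ 0) :
    HasJordanType (locusMatrix u r k a g h b) P := by
  have hau : IsUnit a := isUnit_iff_constantCoeff.2 (isUnit_iff_ne_zero.2 ha)
  obtain ⟨c, rfl⟩ : ∃ c, h = c * a := by
    obtain ⟨c, hc⟩ := hau.dvd (a := h)
    exact ⟨c, by rw [hc, mul_comm]⟩
  have hb : X ^ (k + (u - r) - r) ∣ b - g * c := by
    rw [← hau.dvd_mul_left (u := a)]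
    convert hdvd using 1
    ring
  rw [map_mul] at hgh hagh
  have hgc : constantCoeff c * constantCoeff g ≠ 0 := fun h0 => hgh (by
    linear_combination constantCoeff a * h0)
  rcases lt_trichotomy k (r - k) with hlt | heq | hlt
  · rw [min_eq_left hlt.le] at hP
    refine hasJordanType_locusMatrix hru hkr (by omega) (by omega) (by omega) hP ha
      (w := a + X ^ (r - k - k) * c * g) ?_ ?_ hb
    · have : r - k - k ≠ 0 := by omega
      simpa [this] using ha
    · rw [show r - k = k + (r - k - k) by omega, pow_add]
      simp only [Nat.add_sub_cancel_left]
      ring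
  · rw [min_eq_left heq.le] at hP
    refine hasJordanType_locusMatrix hru hkr (by omega) (by omega) (by omega) hP ha
      (w := a + c * g) ?_ ?_ hb
    · intro h0
      rw [map_add, map_mul] at h0
      exact hagh (by linear_combination constantCoeff a * h0)
    · rw [← heq]
      ring
  · rw [min_eq_right hlt.le] at hP
    refine hasJordanType_locusMatrix hru hkr (by omega) (by omega) (by omega) hP ha
      (w := X ^ (k - (r - k)) * a + c * g) ?_ ?_ hb
    · have : k - (r - k) ≠ 0 := by omega
      simpa [this] using hgc
    · have : (X : K⟦X⟧) ^ k = X ^ (r - k) * X ^ (k - (r - k)) := by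
        rw [← pow_add]
        congr 1
        omega
      rw [this]
      ring

end JordanType

/-! ### Density of the generic elements -/

section Density

open PowerSeries Filter

variable {K : Type*} [Field K]

/-- If almost all points of a parabola lie in a Zariski closed set then all do. -/
theorem IsZariskiClosed.mem_of_eventually [Infinite K] {ι : Type*} {Y : Set (Matrix ι ι K)}
    (hY : IsZariskiClosed Y) {M₀ M₁ M₂ : Matrix ι ι K}
    (h : ∀ᶠ s : K in cofinite, M₀ + s • M₁ + s ^ 2 • M₂ ∈ Y) : M₀ ∈ Y := by
  obtain ⟨E, rfl⟩ := hY
  intro p hp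
  let q : Polynomial K := MvPolynomial.aeval (fun x : ι × ι => Polynomial.C (M₀ x.1 x.2) +
    Polynomial.X * Polynomial.C (M₁ x.1 x.2) + Polynomial.X ^ 2 * Polynomial.C (M₂ x.1 x.2)) p
  have hq : ∀ s, q.eval s =
      MvPolynomial.eval (fun x : ι × ι => (M₀ + s • M₁ + s ^ 2 • M₂) x.1 x.2) p := by
    intro s
    rw [← Polynomial.coe_evalRingHom]
    simp only [q]
    rw [MvPolynomial.aeval_def, MvPolynomial.hom_eval₂]
    change _ = MvPolynomial.eval₂ (RingHom.id K) _ p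
    congr 1
    · ext; simp
    · ext; simp; ring
  have hq0 : q = 0 := by
    refine Polynomial.eq_zero_of_infinite_isRoot q ?_
    have := (eventually_cofinite.1 h).infinite_compl
    refine this.mono fun s hs => ?_
    rw [Set.mem_ofPred, Polynomial.IsRoot, hq]
    exact (not_not.1 hs) p hp
  have := hq 0
  rw [hq0, Polynomial.eval_zero] at this
  simpa using this.symm

theorem eventually_add_mul_ne_zero (α : K) {β : K} (hβ : β ≠ 0) :
    ∀ᶠ s : K in cofinite, α + s * β ≠ 0 := by
  rw [eventually_cofinite]
  refine (Set.finite_singleton (-α / β)).subset fun s hs => ?_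
  rw [Set.mem_ofPred, not_not] at hs
  rw [Set.mem_singleton_iff, eq_div_iff hβ]
  linear_combination hs

theorem eventually_quadratic_ne_zero (α β : K) :
    ∀ᶠ s : K in cofinite, α + s * β + s ^ 2 ≠ 0 := by
  have hp : (Polynomial.X ^ 2 + (Polynomial.X * Polynomial.C β + Polynomial.C α)).Monic := by
    monicity!
  rw [eventually_cofinite]
  refine (Polynomial.finite_setOfPred_isRoot hp.ne_zero).subset fun s hs => ?_
  rw [Set.mem_ofPred, not_not] at hs
  rw [Set.mem_ofPred, Polynomial.IsRoot]
  simp only [Polynomial.eval_add, Polynomial.eval_mul, Polynomial.eval_pow, Polynomial.eval_X,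
    Polynomial.eval_C]
  linear_combination hs

theorem locusMatrix_add (u r k : ℕ) (a g h b a' g' h' b' : K⟦X⟧) :
    locusMatrix u r k (a + a') (g + g') (h + h') (b + b') =
      locusMatrix u r k a g h b + locusMatrix u r k a' g' h' b' := by
  simp only [locusMatrix, pairMatrix, mul_add, toeplitz_add, Matrix.fromBlocks_add]

theorem locusMatrix_C_mul (u r k : ℕ) (s : K) (a g h b : K⟦X⟧) :
    locusMatrix u r k (C s * a) (C s * g) (C s * h) (C s * b) =
      s • locusMatrix u r k a g h b := by
  simp only [locusMatrix, pairMatrix, mul_left_comm _ (C s), toeplitz_C_mul,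
    Matrix.fromBlocks_smul]

theorem locusMatrix_mem_of_eventually [Infinite K] {u r k : ℕ} {Y : Set (BlockMatrix K u r)}
    (hY : IsZariskiClosed Y) {a g h b : K⟦X⟧} (a₁ g₁ h₁ b₁ a₂ g₂ h₂ b₂ : K⟦X⟧)
    (hs : ∀ᶠ s : K in cofinite, locusMatrix u r k (a + C s * a₁ + C (s ^ 2) * a₂)
      (g + C s * g₁ + C (s ^ 2) * g₂) (h + C s * h₁ + C (s ^ 2) * h₂)
      (b + C s * b₁ + C (s ^ 2) * b₂) ∈ Y) : locusMatrix u r k a g h b ∈ Y := by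
  simp only [locusMatrix_add, locusMatrix_C_mul] at hs
  exact hY.mem_of_eventually hs

/-- A Zariski closed set which contains the generic part of the locus contains the locus. -/
theorem locusMatrix_mem_of_generic_subset [Infinite K] {u r k m : ℕ}
    {Y : Set (BlockMatrix K u r)} (hY : IsZariskiClosed Y)
    (hgen : ∀ a g h b : K⟦X⟧, X ^ m ∣ a * b - g * h → constantCoeff a ≠ 0 →
      constantCoeff g * constantCoeff h ≠ 0 →
      constantCoeff a ^ 2 + constantCoeff g * constantCoeff h ≠ 0 →
      locusMatrix u r k a g h b ∈ Y)
    {a g h b : K⟦X⟧} (hdvd : X ^ m ∣ a * b - g * h) : locusMatrix u r k a g h b ∈ Y := by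
  have step₁ : ∀ a g h b : K⟦X⟧, X ^ m ∣ a * b - g * h → constantCoeff a ≠ 0 →
      constantCoeff g ≠ 0 → locusMatrix u r k a g h b ∈ Y := by
    intro a g h b hdvd ha hg
    -- Adding `s (a, g)` to `(h, b)` leaves `ab - gh` unchanged.
    refine locusMatrix_mem_of_eventually hY 0 0 a g 0 0 0 0 ?_
    filter_upwards [eventually_add_mul_ne_zero (constantCoeff h) ha,
      eventually_add_mul_ne_zero (constantCoeff a ^ 2 + constantCoeff g * constantCoeff h)
        (mul_ne_zero hg ha)] with s h1 h2
    refine hgen _ _ _ _ ?_ ?_ ?_ ?_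
    · convert hdvd using 1
      ring
    · simpa using ha
    · simpa using ⟨hg, h1⟩
    · convert h2 using 1
      simp
      ring
  have step₂ : ∀ a g c b : K⟦X⟧, X ^ m ∣ a * b - g * (c * a) →
      locusMatrix u r k a g (c * a) b ∈ Y := by
    intro a g c b hdvd
    -- With `b = cg + δ`, the deformation has `a' = a + sg + s²`, `g' = g + s`, `h' = ca' + sδ`, `b'
    -- = cg' + δ`. Then `a'b' - g'h' = δ (a' - sg') = δa` is unchanged, while `a'` and `g'` become
    -- units for almost all `s`.
    refine locusMatrix_mem_of_eventually hY g 1 (c * g + (b - c * g)) c 1 0 c 0 ?_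
    filter_upwards [eventually_quadratic_ne_zero (constantCoeff a) (constantCoeff g),
      eventually_add_mul_ne_zero (constantCoeff g) one_ne_zero] with s h1 h2
    refine step₁ _ _ _ _ ?_ ?_ ?_
    · convert hdvd using 1
      rw [map_pow]
      ring
    · simpa using h1
    · simpa using h2
  rcases ValuationRing.dvd_total a h with ⟨c, rfl⟩ | ⟨c, rfl⟩
  · rw [mul_comm a c] at hdvd ⊢
    exact step₂ _ _ _ _ hdvd
  -- Here `a = hc`. Adding `s (h, b)` to `(a, g)` preserves `ab - gh` and turns `a` into `h (c +
  -- s)`, a unit multiple of `h` for almost all `s`, so the previous step applies.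
  · refine locusMatrix_mem_of_eventually hY h b 0 0 0 0 0 0 ?_
    filter_upwards [eventually_add_mul_ne_zero (constantCoeff c) one_ne_zero] with s hs
    have hu : IsUnit (c + C s) := by
      rw [isUnit_iff_constantCoeff, isUnit_iff_ne_zero]
      simpa using hs
    obtain ⟨c', hc'⟩ := hu.exists_left_inv
    have hh : h + C s * 0 + C (s ^ 2) * 0 = c' * (h * c + C s * h + C (s ^ 2) * 0) := by
      linear_combination (-h) * hc'
    rw [hh]
    refine step₂ _ _ _ _ ?_
    rw [← hh]
    convert hdvd using 1
    ring

/-- The locus where one of the conditions defining the generic elements fails. -/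
theorem isZariskiClosed_degenerate {u r k : ℕ} (hku : k < u) (hru : r < u) :
    IsZariskiClosed {B : BlockMatrix K u r | coordA B k * (coordG B 0 * coordH B 0) *
      (coordA B k ^ 2 + coordG B 0 * coordH B 0) = 0} := by
  have ht : 0 < u - r := by omega
  let pa : MvPolynomial ((Fin u ⊕ Fin (u - r)) × (Fin u ⊕ Fin (u - r))) K :=
    MvPolynomial.X (Sum.inl ⟨0, by omega⟩, Sum.inl ⟨k, hku⟩)
  let pg : MvPolynomial ((Fin u ⊕ Fin (u - r)) × (Fin u ⊕ Fin (u - r))) K :=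
    MvPolynomial.X (Sum.inl ⟨0, by omega⟩, Sum.inr ⟨0, ht⟩)
  let ph : MvPolynomial ((Fin u ⊕ Fin (u - r)) × (Fin u ⊕ Fin (u - r))) K :=
    MvPolynomial.X (Sum.inr ⟨0, ht⟩, Sum.inl ⟨r + 0, by omega⟩)
  refine ⟨{pa * (pg * ph) * (pa ^ 2 + pg * ph)}, ?_⟩
  ext B
  simp only [coordA, coordG, coordH, dif_pos hku, dif_pos ht, Set.mem_ofPred,
    Set.mem_singleton_iff, forall_eq, map_mul, map_add, map_pow, pa, pg, ph, MvPolynomial.eval_X]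

end Density

theorem mainTheorem4 (K : Type*) [Field K] [Infinite K] (u r k : ℕ) (hr : 2 ≤ r) (hru : r < u)
    (hk : 1 ≤ k) (hkr : k ≤ r - 1) :
    ∃ P : (u + (u - r)).Partition,
      burgeCode P.parts = tableWord u r k (u - r) ∧
      (∀ P' : Multiset ℕ, (∀ i ∈ P', 0 < i) →
        burgeCode P' = tableWord u r k (u - r) → P' = P.parts) ∧
      HoldsGenerically (locusX K u r k (u - r)) fun B => HasJordanType B P := by
  set m := min k (r - k) with hm
  have hcode := burgeCode_table hru hk hkr
  rw [← hm] at hcode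
  have hpos : ∀ i ∈ balanced m (u - k + m) + Multiset.replicate (u - r + k - m) 1, 0 < i := by
    intro i hi
    rcases Multiset.mem_add.1 hi with hi | hi
    · exact pos_of_mem_balanced (by omega) hi
    · rw [Multiset.eq_of_mem_replicate hi]
      exact one_pos
  let P : (u + (u - r)).Partition :=
    { parts := balanced m (u - k + m) + Multiset.replicate (u - r + k - m) 1
      parts_pos := fun {i} hi => hpos i hi
      parts_sum := by
        rw [Multiset.sum_add, sum_balanced (by omega), Multiset.sum_replicate, smul_eq_mul]
        omega }
  have hcoord : ∀ a g h b : PowerSeries K,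
      coordA (locusMatrix u r k a g h b) k = PowerSeries.constantCoeff a ∧
      coordG (locusMatrix u r k a g h b) 0 = PowerSeries.constantCoeff g ∧
      coordH (locusMatrix u r k a g h b) 0 = PowerSeries.constantCoeff h := by
    intro a g h b
    rw [locusMatrix, coordA_pairMatrix _ _ _ _ (by omega), coordG_pairMatrix _ _ _ _ (by omega),
      coordH_pairMatrix _ _ _ _ (by omega)]
    have := PowerSeries.coeff_X_pow_mul a k 0
    rw [zero_add] at this
    rw [this]
    simp
  refine ⟨P, hcode, fun P' hP' hcode' => burgeCode_injective hP' hpos (hcode'.trans hcode.symm),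
    _, isZariskiClosed_degenerate (k := k) (by omega) hru, ?_, ?_⟩
  · intro Y hY hsub B hB
    obtain ⟨a, g, h, b, rfl, hdvd⟩ := (mem_locusX_iff hru hk hkr).1 hB
    refine locusMatrix_mem_of_generic_subset hY (fun a g h b hdvd ha hgh hagh => ?_) hdvd
    refine hsub ⟨(mem_locusX_iff hru hk hkr).2 ⟨a, g, h, b, rfl, hdvd⟩, ?_⟩
    obtain ⟨h1, h2, h3⟩ := hcoord a g h b
    rw [Set.mem_ofPred, h1, h2, h3]
    exact mul_ne_zero (mul_ne_zero ha hgh) hagh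
  · rintro B ⟨hB, hZ⟩
    obtain ⟨a, g, h, b, rfl, hdvd⟩ := (mem_locusX_iff hru hk hkr).1 hB
    obtain ⟨h1, h2, h3⟩ := hcoord a g h b
    rw [Set.mem_ofPred, h1, h2, h3, mul_eq_zero, mul_eq_zero, not_or, not_or] at hZ
    exact hasJordanType_of_generic hru hk hkr rfl hdvd hZ.1.1 hZ.1.2 hZ.2
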